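/- **Theorem.** The Scherer–Lea–Scott synchronous queue is linearizable with respect to the sequential first-in-first-out queue. *The object.* Nodes have an item (a value or null), an immutable type (item or reservation) and a next pointer; memory is never reused. The shared variables head and tail initially point to one dummy node (null item, type "item", null next). Every thread performs at most one invocation, enq$(e)$ with $e\neq$ null, or deq$()$; any number of threads interleave, each read, test or compare-and-set (CAS) being one atomic step. - enq$(e)$ allocates offer $=$ (item $e$, type "item", next null) and repeats: $t:=$ tail; $h:=$ head. - If $h=t$ or $t$.type is "item": $n:=t$.next; if tail $\ne t$, restart; if $n\neq$ null, CAS(tail, $t$, $n$) and restart; otherwise CAS($t$.next, $n$, offer), restarting on failure. On success: CAS(tail, $t$, offer); wait until offer.item $\neq e$; $h:=$ head; if offer $=h$.next then CAS(head, $h$, offer); return. - Otherwise: $n:=h$.next; restart if tail $\neq t$ or head $\neq h$ or $n=$ null; perform CAS($n$.item, null, $e$), then CAS(head, $h$, $n$); return if the first CAS succeeded, else restart. - deq$()$ is dual. It allocates offer $=$ (item null, type "reservation", next null). It takes the first branch if $h=t$ or $t$.type is "reservation", waits there until offer.item $\neq$ null, and finally returns offer.item. In the second branch it reads $x:=n$.item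 and, if $x\ne$ null, performs CAS($n$.item, $x$, null); then, in every case, CAS(head, $h$, $n$); it returns $x$ if its CAS on $n$.item succeeded and restarts otherwise. *Linearizability.* For the trace $\tau$ of every finite execution (completed or not) there are an order on a set of invoked operations containing all those that returned, returned values for those among them that have not returned, and positions of $\tau$ (linearization points, possibly shared, non-decreasing along the order), each strictly between the invocation of the operation and its return (if any), such that the resulting sequence of operations is a legal run of the FIFO queue from the empty queue (a dequeue returns the oldest element; there is no dequeue from the empty queue). *Form of the linearization.* Name the successful CAS steps as follows: $\mathit{Eapp}$, $\mathit{Dapp}$ (on $t$.next, by an enqueue or a dequeue), $\mathit{TA}$ (on tail), $\mathit{Eswap}$, $\mathit{Dswap}$ (on $n$.item, by an enqueue or a dequeue), $\mathit{HR}$ (on head). Every finite execution $\tau$ can be extended by at most two further steps (by none if all invoked operations have returned in $\tau$) to an execution $\tau'$ such that the sequence of successful CAS steps of $\tau'$ can be rearranged into a word $w$ of $$\big([\mathit{Dapp}\cdot \mathit{TA}\cdot(\mathit{Eswap}\cdot \mathit{HR}\cdot \mathit{Dapp}\cdot \mathit{TA})^*\cdot \mathit{Eswap}\cdot \mathit{HR}]+[\mathit{Eapp}\cdot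 \mathit{TA}\cdot(\mathit{Dswap}\cdot \mathit{HR}\cdot \mathit{Eapp}\cdot \mathit{TA})^*\cdot \mathit{Dswap}\cdot \mathit{HR}]\big)^*\cdot\big([\mathit{Dapp}\cdot \mathit{TA}]^*+[\mathit{Eapp}\cdot \mathit{TA}]^*\big),$$ where the only rearrangement allowed is, repeatedly, to move an $\mathit{Eswap}$, $\mathit{Dswap}$ or $\mathit{HR}$ ahead of an immediately preceding $\mathit{Eapp}$, $\mathit{Dapp}$ or $\mathit{TA}$ of a different thread. Moreover, $\tau'$ has a linearization as above (a legal run of the FIFO queue) whose sequence of enqueues ($E$) and dequeues ($D$) is the projection of $w$ under $\mathit{Eapp}\mapsto E$, $\mathit{Eswap}\mapsto E\cdot D$, $\mathit{Dswap}\mapsto D$, all other letters being erased. This projection maps every word of the expression into $(E\cdot D)^*\cdot(E^*+D^*)$. -/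

import Mathlib

/-! ### Concurrent objects: code, executions, traces -/

/-- Kleene-algebra-with-tests code over primitive actions `A` and primitive tests `B`.
`ntest b` is the negation of the test `b`; `arw b a` is the atomic read-write that tests `b` and,
without any interleaving, performs `a`; `ret` returns from the method. -/
inductive Kat (A B : Type*) where
  | one : Kat A B
  | act : A → Kat A B
  | test : B → Kat A B
  | ntest : B → Kat A B
  | arw : B → A → Kat A B
  | ret : Kat A B
  | seq : Kat A B → Kat A B → Kat A B
  | plus : Kat A B → Kat A B → Kat A B
  | star : Kat A B → Kat A B

infixr:70 " ⨟ " => Kat.seq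
infixr:65 " ⊞ " => Kat.plus

/-- Labels of an execution: invocations (a method with its arguments), primitive actions, tests
(with their outcome), successful atomic read-writes, and returns (with the returned value). -/
inductive Label (I R A B : Type*) where
  | inv : I → Label I R A B
  | act : A → Label I R A B
  | test : B → Bool → Label I R A B
  | arw : B → A → Label I R A B
  | ret : R → Label I R A B

/-- A concurrent object. `I` is the type of invocations (method and arguments), `R` of returned
values, `L` of local states, `G` of shared states. -/
structure ConcObject (I R L G A B : Type*) where
  code : I → Kat A B
  localInit : I → L
  sharedInit : G
  actSem : A → L → G → L × G
  testSem : B → L → G → Prop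
  retVal : L → R

namespace Kat

variable {A B : Type*}

/-- The code can terminate without performing any labelled step. -/
inductive Nullable : Kat A B → Prop
  | one : Nullable one
  | seq {k k'} : Nullable k → Nullable k' → Nullable (seq k k')
  | plusL {k k'} : Nullable k → Nullable (plus k k')
  | plusR {k k'} : Nullable k' → Nullable (plus k k')
  | star {k} : Nullable (star k)

end Kat

/-- One labelled step of a single thread, all label-free nondeterminism (choices, loop unfoldings)
before the label being resolved. The code `none` means that the thread has returned. -/
inductive ConcObject.ThreadStep {I R L G A B : Type*} (O : ConcObject I R L G A B)
    (l : L) (g : G) : Kat A B → Label I R A B → L → G → Option (Kat A B) → Prop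
  | act (a : A) :
      ThreadStep O l g (.act a) (.act a) (O.actSem a l g).1 (O.actSem a l g).2 (some .one)
  | test (b : B) (h : O.testSem b l g) :
      ThreadStep O l g (.test b) (.test b true) l g (some .one)
  | ntest (b : B) (h : ¬ O.testSem b l g) :
      ThreadStep O l g (.ntest b) (.test b false) l g (some .one)
  | arw (b : B) (a : A) (h : O.testSem b l g) :
      ThreadStep O l g (.arw b a) (.arw b a) (O.actSem a l g).1 (O.actSem a l g).2 (some .one)
  | ret : ThreadStep O l g .ret (.ret (O.retVal l)) l g none
  | plusL {k k' : Kat A B} {ℓ l' g' r} :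
      ThreadStep O l g k ℓ l' g' r → ThreadStep O l g (.plus k k') ℓ l' g' r
  | plusR {k k' : Kat A B} {ℓ l' g' r} :
      ThreadStep O l g k' ℓ l' g' r → ThreadStep O l g (.plus k k') ℓ l' g' r
  | seqL {k k' : Kat A B} {ℓ l' g' r} :
      ThreadStep O l g k ℓ l' g' r →
        ThreadStep O l g (.seq k k') ℓ l' g' (r.map fun k₁ => .seq k₁ k')
  | seqR {k k' : Kat A B} {ℓ l' g' r} :
      k.Nullable → ThreadStep O l g k' ℓ l' g' r → ThreadStep O l g (.seq k k') ℓ l' g' r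
  | star {k : Kat A B} {ℓ l' g' r} :
      ThreadStep O l g k ℓ l' g' r →
        ThreadStep O l g (.star k) ℓ l' g' (r.map fun k₁ => .seq k₁ (.star k))

/-- A configuration: the shared state, and for every thread that has been invoked its local state
and remaining code (`none` for the code once it has returned). -/
structure Config (T L G A B : Type*) where
  shared : G
  thread : T → Option (L × Option (Kat A B))

/-- Every invoked thread has returned. -/
def Config.Final {T L G A B : Type*} (C : Config T L G A B) : Prop :=
  ∀ t l k, C.thread t = some (l, k) → k = none

namespace ConcObject

variable {I R L G A B T : Type*} [DecidableEq T]

/-- `O.Exec env τ C`: `τ` is the trace of an execution of `O` that starts in the initial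
configuration and ends in `C`. The environment `env` says which threads may perform an invocation,
and which one; every thread performs at most one. -/
inductive Exec (O : ConcObject I R L G A B) (env : T → Option I) :
    List (T × Label I R A B) → Config T L G A B → Prop
  | init : Exec O env [] ⟨O.sharedInit, fun _ => none⟩
  | inv {τ C} (t : T) (i : I) : Exec O env τ C → env t = some i → C.thread t = none →
      Exec O env (τ ++ [(t, .inv i)])
        ⟨C.shared, Function.update C.thread t (some (O.localInit i, some (O.code i)))⟩
  | step {τ C} (t : T) {l l' : L} {k : Kat A B} {ℓ : Label I R A B} {g' : G}
      {r : Option (Kat A B)} : Exec O env τ C → C.thread t = some (l, some k) →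
      O.ThreadStep l C.shared k ℓ l' g' r →
      Exec O env (τ ++ [(t, ℓ)]) ⟨g', Function.update C.thread t (some (l', r))⟩

end ConcObject

/-! ### Linearizability -/

/-- `s` lists threads with their operation symbols (invocation and returned value), in the order of
linearization points. Every operation that returned in `τ` is listed; operations that were invoked
but have not returned may be listed, with a suitable returned value. The linearization point
`lp t` is a position of the trace after the invocation and before the return (if any) of `t`; one
position may serve as the linearization point of several threads. -/
structure IsLinearization {I R A B T : Type*} (S : Set (List (I × R)))
    (τ : List (T × Label I R A B)) (s : List (T × I × R)) : Prop where
  nodup : (s.map Prod.fst).Nodup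
  returned : ∀ t r, (t, Label.ret r) ∈ τ → ∃ i, (t, i, r) ∈ s
  invoked : ∀ t i r, (t, i, r) ∈ s → (t, Label.inv i) ∈ τ
  points : ∃ lp : T → ℕ,
    (∀ x ∈ s, lp x.1 < τ.length ∧
      (∀ j i, τ[j]? = some (x.1, Label.inv i) → j < lp x.1) ∧
      (∀ j r, τ[j]? = some (x.1, Label.ret r) → lp x.1 < j)) ∧
    s.Pairwise fun x y => lp x.1 ≤ lp y.1
  spec : s.map Prod.snd ∈ S

/-- All traces of executions of `O` (completed or not), by any set of threads of the type `T`, are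
linearizable with respect to `S`. -/
def ConcObject.Linearizable {I R L G A B : Type*} (O : ConcObject I R L G A B)
    (S : Set (List (I × R))) (T : Type*) [DecidableEq T] : Prop :=
  ∀ (env : T → Option I) τ C, O.Exec env τ C → ∃ s, IsLinearization S τ s

/-! ### The sequential queue -/

inductive QInv (V : Type*) where
  | enq : V → QInv V
  | deq : QInv V

/-- `QueueRun q w`: from the queue content `q` (oldest element first), the sequence `w` of
operations is a legal run of a first-in-first-out queue. An enqueue returns nothing. -/
inductive QueueRun {V : Type*} : List V → List (QInv V × Option V) → Prop
  | nil (q : List V) : QueueRun q []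
  | enq {q : List V} {w} (v : V) : QueueRun (q ++ [v]) w → QueueRun q ((.enq v, none) :: w)
  | deq {q : List V} {w} (v : V) : QueueRun q w → QueueRun (v :: q) ((.deq, some v) :: w)

def queueSpec (V : Type*) : Set (List (QInv V × Option V)) := {w | QueueRun [] w}

/-! ### The synchronous reservation queue of Scherer, Lea and Scott -/

namespace SLS

inductive NodeType where
  | item
  | reservation

/-- A node; `item = none` is the null value, `next = none` the null pointer. -/
structure Node (V : Type*) where
  item : Option V
  type : NodeType
  next : Option ℕ

/-- The shared memory. Addresses are numbers, those below `size` are allocated, and memory is never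
reused. -/
structure Shared (V : Type*) where
  head : ℕ
  tail : ℕ
  size : ℕ
  node : ℕ → Node V

/-- The local variables: the argument (null for a dequeue), the own node, the node variables
`t`, `h`, `n`, and the value `x` that a dequeue returns. -/
structure Loc (V : Type*) where
  arg : Option V
  offer : ℕ
  t : ℕ
  h : ℕ
  n : Option ℕ
  x : Option V

inductive Act where
  | newOffer (ty : NodeType) -- offer := new Node(arg, ty)
  | readTail                 -- t := tail
  | readHead                 -- h := head
  | readTNext                -- n := t.next
  | readHNext                -- n := h.next
  | readNItem                -- x := n.item
  | readOfferItem            -- x := offer.item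
  | linkOffer                -- t.next := offer
  | tailToN                  -- tail := n
  | tailToOffer              -- tail := offer
  | headToN                  -- head := n
  | headToOffer              -- head := offer
  | putArg                   -- n.item := arg
  | putNull                  -- n.item := null

inductive Tst where
  | hIsT                     -- h = t
  | tType (ty : NodeType)    -- t.type = ty
  | tailIsT                  -- tail = t
  | headIsH                  -- head = h
  | nIsNull                  -- n = null
  | tNextIsN                 -- t.next = n
  | offerItemIsArg           -- offer.item = arg
  | offerIsHNext             -- offer = h.next
  | nItemIsNull              -- n.item = null
  | nItemIsX                 -- n.item = x
  | xIsNull                  -- x = null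

variable {V : Type*}

def Shared.setNode (g : Shared V) (p : ℕ) (v : Node V) : Shared V :=
  { g with node := Function.update g.node p v }

/-- The address in a pointer; it is only used for pointers that were tested not to be null. -/
def addr (p : Option ℕ) : ℕ := p.getD 0

def actSem : Act → Loc V → Shared V → Loc V × Shared V
  | .newOffer ty, l, g =>
      ({ l with offer := g.size }, { g.setNode g.size ⟨l.arg, ty, none⟩ with size := g.size + 1 })
  | .readTail, l, g => ({ l with t := g.tail }, g)
  | .readHead, l, g => ({ l with h := g.head }, g)
  | .readTNext, l, g => ({ l with n := (g.node l.t).next }, g)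
  | .readHNext, l, g => ({ l with n := (g.node l.h).next }, g)
  | .readNItem, l, g => ({ l with x := (g.node (addr l.n)).item }, g)
  | .readOfferItem, l, g => ({ l with x := (g.node l.offer).item }, g)
  | .linkOffer, l, g => (l, g.setNode l.t { g.node l.t with next := some l.offer })
  | .tailToN, l, g => (l, { g with tail := addr l.n })
  | .tailToOffer, l, g => (l, { g with tail := l.offer })
  | .headToN, l, g => (l, { g with head := addr l.n })
  | .headToOffer, l, g => (l, { g with head := l.offer })
  | .putArg, l, g => (l, g.setNode (addr l.n) { g.node (addr l.n) with item := l.arg })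
  | .putNull, l, g => (l, g.setNode (addr l.n) { g.node (addr l.n) with item := none })

def testSem : Tst → Loc V → Shared V → Prop
  | .hIsT, l, _ => l.h = l.t
  | .tType ty, l, g => (g.node l.t).type = ty
  | .tailIsT, l, g => g.tail = l.t
  | .headIsH, l, g => g.head = l.h
  | .nIsNull, l, _ => l.n = none
  | .tNextIsN, l, g => (g.node l.t).next = l.n
  | .offerItemIsArg, l, g => (g.node l.offer).item = l.arg
  | .offerIsHNext, l, g => (g.node l.h).next = some l.offer
  | .nItemIsNull, l, g => (g.node (addr l.n)).item = none
  | .nItemIsX, l, g => (g.node (addr l.n)).item = l.x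
  | .xIsNull, l, _ => l.x = none

open Kat in
/-- A compare-and-set whose result is ignored. -/
def cas (b : Tst) (a : Act) : Kat Act Tst := arw b a ⊞ ntest b

open Kat in
/-- The branch that appends the own node to the list and waits until its item has been changed;
`fin` is the end of the method. -/
def appendBranch (fin : Kat Act Tst) : Kat Act Tst :=
  act .readTNext ⨟
    (ntest .tailIsT ⊞
      test .tailIsT ⨟
        (ntest .nIsNull ⨟ cas .tailIsT .tailToN ⊞
          test .nIsNull ⨟
            (ntest .tNextIsN ⊞
              arw .tNextIsN .linkOffer ⨟ cas .tailIsT .tailToOffer ⨟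
                star (test .offerItemIsArg) ⨟ ntest .offerItemIsArg ⨟
                act .readHead ⨟
                (ntest .offerIsHNext ⊞ test .offerIsHNext ⨟ cas .headIsH .headToOffer) ⨟ fin)))

open Kat in
/-- The branch that works on the successor of the head node; `swap` is the attempt to exchange the
item of that node, once it is known to exist. -/
def swapBranch (swap : Kat Act Tst) : Kat Act Tst :=
  act .readHNext ⨟
    (ntest .tailIsT ⊞
      test .tailIsT ⨟ (ntest .headIsH ⊞ test .headIsH ⨟ (test .nIsNull ⊞ ntest .nIsNull ⨟ swap)))

open Kat in
/-- A method: allocate a node of type `ty`; then repeatedly read the tail and the head and take the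
append branch if the list is empty or consists of nodes of type `ty`, else the swap branch. -/
def method (ty : NodeType) (fin swap : Kat Act Tst) : Kat Act Tst :=
  act (.newOffer ty) ⨟
    star (act .readTail ⨟ act .readHead ⨟
      ((test .hIsT ⊞ ntest .hIsT ⨟ test (.tType ty)) ⨟ appendBranch fin ⊞
        ntest .hIsT ⨟ ntest (.tType ty) ⨟ swapBranch swap))

open Kat in
def enqCode : Kat Act Tst :=
  method .item ret
    (arw .nItemIsNull .putArg ⨟ cas .headIsH .headToN ⨟ ret ⊞
      ntest .nItemIsNull ⨟ cas .headIsH .headToN)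

open Kat in
def deqCode : Kat Act Tst :=
  method .reservation (act .readOfferItem ⨟ ret)
    (act .readNItem ⨟
      (test .xIsNull ⨟ cas .headIsH .headToN ⊞
        ntest .xIsNull ⨟
          (arw .nItemIsX .putNull ⨟ cas .headIsH .headToN ⨟ ret ⊞
            ntest .nItemIsX ⨟ cas .headIsH .headToN)))

/-- The synchronous queue with elements in `V`: initially the list consists of a dummy node, to
which both `head` and `tail` point. An enqueue returns no value (its variable `x` stays null). -/
def queue (V : Type*) : ConcObject (QInv V) (Option V) (Loc V) (Shared V) Act Tst where
  code
    | .enq _ => enqCode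
    | .deq => deqCode
  localInit
    | .enq v => ⟨some v, 0, 0, 0, none, none⟩
    | .deq => ⟨none, 0, 0, 0, none, none⟩
  sharedInit := ⟨0, 0, 1, fun _ => ⟨none, .item, none⟩⟩
  actSem := actSem
  testSem := testSem
  retVal l := l.x

/-! ### Layers and their linearization points -/

/-- The kinds of layers, each named by its shared-memory write: appending the node of an enqueue
or dequeue, exchanging an item by an enqueue or dequeue, advancing the tail, advancing the head. -/
inductive Layer where
  | Eapp
  | Dapp
  | Eswap
  | Dswap
  | TA
  | HR

/-- The layer that a label of a thread executing a given invocation writes for, if any. -/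
def layerOf : QInv V → Label (QInv V) (Option V) Act Tst → Option Layer
  | .enq _, .arw _ .linkOffer => some .Eapp
  | .deq, .arw _ .linkOffer => some .Dapp
  | _, .arw _ .putArg => some .Eswap
  | _, .arw _ .putNull => some .Dswap
  | _, .arw _ .tailToN => some .TA
  | _, .arw _ .tailToOffer => some .TA
  | _, .arw _ .headToN => some .HR
  | _, .arw _ .headToOffer => some .HR
  | _, _ => none

/-- The sequence of writes of a trace, each with its thread. -/
def writes {T : Type*} (env : T → Option (QInv V))
    (τ : List (T × Label (QInv V) (Option V) Act Tst)) : List (T × Layer) :=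
  τ.filterMap fun x => (env x.1).bind fun i => (layerOf i x.2).map fun y => (x.1, y)

/-- Writes to `next` fields and to `tail`. -/
def Layer.TailSide : Layer → Prop
  | .Eapp | .Dapp | .TA => True
  | _ => False

/-- Writes to `item` fields and to `head`. -/
def Layer.HeadSide : Layer → Prop
  | .Eswap | .Dswap | .HR => True
  | _ => False

/-- Exchange of two adjacent writes of different threads (to disjoint parts of the memory): a write
on the head side moves ahead of a write on the tail side. -/
inductive Exchange {T : Type*} : List (T × Layer) → List (T × Layer) → Prop
  | mk (u v : List (T × Layer)) (x y : T × Layer) : x.1 ≠ y.1 → x.2.TailSide → y.2.HeadSide →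
      Exchange (u ++ x :: y :: v) (u ++ y :: x :: v)

open RegularExpression (char) in
/-- `([Dapp·TA·(Eswap·HR·Dapp·TA)*·Eswap·HR] + [Eapp·TA·(Dswap·HR·Eapp·TA)*·Dswap·HR])*
· ([Dapp·TA]* + [Eapp·TA]*)` -/
def layerExpr : RegularExpression Layer :=
  .star
    (char .Dapp * char .TA * .star (char .Eswap * char .HR * char .Dapp * char .TA) *
        char .Eswap * char .HR +
      char .Eapp * char .TA * .star (char .Dswap * char .HR * char .Eapp * char .TA) *
        char .Dswap * char .HR) *
  (.star (char .Dapp * char .TA) + .star (char .Eapp * char .TA))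

inductive ED where
  | E
  | D

def kind : QInv V → ED
  | .enq _ => .E
  | .deq => .D

/-- The linearization points marked in the layers. -/
def marks : Layer → List ED
  | .Eapp => [.E]
  | .Eswap => [.E, .D]
  | .Dswap => [.D]
  | _ => []

open RegularExpression (char) in
/-- `(E·D)*·(E* + D*)` -/
def pointExpr : RegularExpression ED :=
  .star (char .E * char .D) * (.star (char .E) + .star (char .D))

end SLS

/-!
Every appended node contributes a block `Xapp · TA · Yswap · HR` of writes, which occur in this
order: `tail` has to reach a node before its item can be exchanged, and `head` moves past a node
only after the exchange. The tail-side letters `Xapp`, `TA` of consecutive blocks occur in the order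
of the blocks, and so do the head-side letters `Yswap`, `HR`. The writes can therefore be sorted by
block if the head-side writes of block `k` may be moved ahead of the tail-side writes of later
blocks, that is, if these are by other threads. Head-side writes of block `k` are by its appender,
whose tail-side writes belong to blocks up to `k`, or by threads with invocations of the other kind.
The latter write on the tail side only at a node of their own type or when they have seen an empty
list; then `head` has passed every earlier node of the other type, so these writes belong to blocks
up to `k` as well.

The same reasoning shows that the items of all nodes of one type have been exchanged before a node
of the other type is appended. Hence both operations of a block can be linearized at its exchange,
the enqueue first, and a pending enqueue at the end of the trace. After the sorting, only the last
appended node can lack its `TA`, and only the last exchanged one its `HR`; each of these two steps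
can be performed by the thread that has to do so, and leads into the regular expression.
-/

/-! ### One-step behaviour of code -/

namespace Kat

variable {A B : Type*} {k : Kat A B}

/-- An instruction of a thread: `test b o` is a test with the expected outcome `o`. -/
inductive Instr (A B : Type*) where
  | act : A → Instr A B
  | test : B → Bool → Instr A B
  | arw : B → A → Instr A B
  | ret : Instr A B

/-- Boolean form of `Kat.Nullable`. -/
def isNullable : Kat A B → Bool
  | one => true
  | seq k k' => k.isNullable && k'.isNullable
  | plus k k' => k.isNullable || k'.isNullable
  | star _ => true
  | _ => false

theorem isNullable_iff : k.isNullable ↔ k.Nullable := by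
  refine ⟨fun h => ?_, fun h => ?_⟩
  · induction k with
    | one => exact .one
    | star => exact .star
    | seq k k' ih ih' =>
      obtain ⟨h₁, h₂⟩ := Bool.and_eq_true_iff.1 h
      exact .seq (ih h₁) (ih' h₂)
    | plus k k' ih ih' =>
      exact (Bool.or_eq_true_iff.1 h).elim (fun h => .plusL (ih h)) fun h => .plusR (ih' h)
    | _ => simp [isNullable] at h
  · induction h <;> simp_all [isNullable]

/-- Antimirov's linear form: the instructions with which a piece of code can begin, each with the
code that remains after it (`none` after a return). -/
def linearForm : Kat A B → List (Instr A B × Option (Kat A B))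
  | one => []
  | act a => [(.act a, some one)]
  | test b => [(.test b true, some one)]
  | ntest b => [(.test b false, some one)]
  | arw b a => [(.arw b a, some one)]
  | ret => [(.ret, none)]
  | seq k k' =>
      k.linearForm.map (fun x => (x.1, x.2.map fun k₁ => k₁ ⨟ k')) ++
        if k.isNullable then k'.linearForm else []
  | plus k k' => k.linearForm ++ k'.linearForm
  | star k => k.linearForm.map fun x => (x.1, x.2.map fun k₁ => k₁ ⨟ star k)

end Kat

namespace ConcObject

variable {I R L G A B : Type*} {O : ConcObject I R L G A B} {l l' : L} {g g' : G} {k : Kat A B}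
  {ℓ : Label I R A B} {r : Option (Kat A B)} {ι : Kat.Instr A B}

/-- The effect of an instruction, with its label. -/
inductive InstrStep (O : ConcObject I R L G A B) (l : L) (g : G) :
    Kat.Instr A B → Label I R A B → L → G → Prop
  | act (a : A) : InstrStep O l g (.act a) (.act a) (O.actSem a l g).1 (O.actSem a l g).2
  | test (b : B) (h : O.testSem b l g) : InstrStep O l g (.test b true) (.test b true) l g
  | ntest (b : B) (h : ¬ O.testSem b l g) : InstrStep O l g (.test b false) (.test b false) l g
  | arw (b : B) (a : A) (h : O.testSem b l g) :
      InstrStep O l g (.arw b a) (.arw b a) (O.actSem a l g).1 (O.actSem a l g).2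
  | ret : InstrStep O l g .ret (.ret (O.retVal l)) l g

theorem ThreadStep.exists_mem_linearForm (h : O.ThreadStep l g k ℓ l' g' r) :
    ∃ ι, (ι, r) ∈ k.linearForm ∧ O.InstrStep l g ι ℓ l' g' := by
  induction h with
  | act a => exact ⟨_, List.mem_singleton_self _, .act a⟩
  | test b h => exact ⟨_, List.mem_singleton_self _, .test b h⟩
  | ntest b h => exact ⟨_, List.mem_singleton_self _, .ntest b h⟩
  | arw b a h => exact ⟨_, List.mem_singleton_self _, .arw b a h⟩
  | ret => exact ⟨_, List.mem_singleton_self _, .ret⟩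
  | plusL _ ih =>
    obtain ⟨ι, hι, hs⟩ := ih
    exact ⟨ι, List.mem_append_left _ hι, hs⟩
  | plusR _ ih =>
    obtain ⟨ι, hι, hs⟩ := ih
    exact ⟨ι, List.mem_append_right _ hι, hs⟩
  | seqL _ ih =>
    obtain ⟨ι, hι, hs⟩ := ih
    exact ⟨ι, List.mem_append_left _ (List.mem_map_of_mem hι), hs⟩
  | seqR hk _ ih =>
    obtain ⟨ι, hι, hs⟩ := ih
    refine ⟨ι, List.mem_append_right _ ?_, hs⟩
    rwa [if_pos (Kat.isNullable_iff.2 hk)]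
  | star _ ih =>
    obtain ⟨ι, hι, hs⟩ := ih
    exact ⟨ι, List.mem_map_of_mem hι, hs⟩

theorem InstrStep.threadStep (hs : O.InstrStep l g ι ℓ l' g') (hι : (ι, r) ∈ k.linearForm) :
    O.ThreadStep l g k ℓ l' g' r := by
  induction k generalizing r with
  | one => simp [Kat.linearForm] at hι
  | act | test | ntest | arw | ret =>
    obtain ⟨rfl, rfl⟩ := Prod.mk.inj (List.mem_singleton.1 hι)
    cases hs
    constructor <;> assumption
  | seq k k' ih ih' =>
    rcases List.mem_append.1 hι with hι | hι
    · obtain ⟨⟨ι', r'⟩, hι', heq⟩ := List.mem_map.1 hι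
      obtain ⟨rfl, rfl⟩ := Prod.mk.inj heq
      exact .seqL (ih hι')
    · by_cases hk : k.isNullable
      · exact .seqR (Kat.isNullable_iff.1 hk) (ih' (by rwa [if_pos hk] at hι))
      · simp [hk] at hι
  | plus k k' ih ih' =>
    exact (List.mem_append.1 hι).elim (fun h => .plusL (ih h)) fun h => .plusR (ih' h)
  | star k ih =>
    obtain ⟨⟨ι', r'⟩, hι', heq⟩ := List.mem_map.1 hι
    obtain ⟨rfl, rfl⟩ := Prod.mk.inj heq
    exact .star (ih hι')

theorem threadStep_iff : O.ThreadStep l g k ℓ l' g' r ↔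
    ∃ ι, (ι, r) ∈ k.linearForm ∧ O.InstrStep l g ι ℓ l' g' :=
  ⟨ThreadStep.exists_mem_linearForm, fun ⟨_, hι, hs⟩ => hs.threadStep hι⟩

end ConcObject

/-! ### The program counters of the queue -/

namespace SLS

variable {V : Type*}

/-- The type of the nodes offered by an invocation. -/
def tyOf : QInv V → NodeType
  | .enq _ => .item
  | .deq => .reservation

/-- The item of the nodes offered by an invocation. -/
def argOf : QInv V → Option V
  | .enq v => some v
  | .deq => none

open Kat in
/-- The end of an appending operation, after the wait and the advance of the head. -/
def finishCode : QInv V → Kat Act Tst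
  | .enq _ => ret
  | .deq => act .readOfferItem ⨟ ret

open Kat in
/-- The compare-and-set on the item of `n` in a dequeue, after its item `x` has been read, with the
advance of the head that follows it. -/
def casNItemCode : Kat Act Tst :=
  arw .nItemIsX .putNull ⨟ cas .headIsH .headToN ⨟ ret ⊞
    ntest .nItemIsX ⨟ cas .headIsH .headToN

open Kat in
/-- The exchange of an operation with the node `n`, with the advance of the head that follows it. -/
def exchangeCode : QInv V → Kat Act Tst
  | .enq _ =>
      arw .nItemIsNull .putArg ⨟ cas .headIsH .headToN ⨟ ret ⊞
        ntest .nItemIsNull ⨟ cas .headIsH .headToN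
  | .deq =>
      act .readNItem ⨟
        (test .xIsNull ⨟ cas .headIsH .headToN ⊞ ntest .xIsNull ⨟ casNItemCode)

open Kat in
/-- The advance of the head past the own node of a woken thread, with the return. -/
def leaveCode (i : QInv V) : Kat Act Tst :=
  (ntest .offerIsHNext ⊞ test .offerIsHNext ⨟ cas .headIsH .headToOffer) ⨟ finishCode i

open Kat in
/-- What a thread does once the item of its node has been exchanged. -/
def wakeCode (i : QInv V) : Kat Act Tst := ntest .offerItemIsArg ⨟ act .readHead ⨟ leaveCode i

open Kat in
/-- The compare-and-set that appends the own node, with everything that follows its success. -/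
def linkCode (i : QInv V) : Kat Act Tst :=
  ntest .tNextIsN ⊞
    arw .tNextIsN .linkOffer ⨟ cas .tailIsT .tailToOffer ⨟ star (test .offerItemIsArg) ⨟ wakeCode i

open Kat in
/-- The two branches of the main loop. -/
def branchCode (i : QInv V) : Kat Act Tst :=
  (test .hIsT ⊞ ntest .hIsT ⨟ test (.tType (tyOf i))) ⨟ appendBranch (finishCode i) ⊞
    ntest .hIsT ⨟ ntest (.tType (tyOf i)) ⨟ swapBranch (exchangeCode i)

open Kat in
/-- One iteration of the main loop. -/
def loopBody (i : QInv V) : Kat Act Tst := act .readTail ⨟ act .readHead ⨟ branchCode i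

theorem queue_code (i : QInv V) :
    (queue V).code i = .act (.newOffer (tyOf i)) ⨟ .star (loopBody i) := by
  cases i <;> rfl

/-- The program counters of the queue, the same for both methods, except that only a dequeue visits
`swapItem` and `swapCas`. A counter named after a guard or a compare-and-set stands just before it;
`linked` precedes the advance of the tail to the own node, and `swapped` and `missed` precede the
advance of the head after the exchange has succeeded or failed. -/
inductive PC where
  | start | loop | gotTail | gotHead
  | appendGuard | append | appendNext | appendChecked | tailCas | linkCas | linked
  | wait | waiting | woken | wokenHead | headCas | finish
  | swapGuard | swap | swapNext | swapTail | swapHead | swapReady | swapItem | swapCas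
  | swapped | missed
  | atRet | returned

namespace PC

open Kat in
/-- The code of a thread inside the main loop, where `k` remains of the current iteration. -/
def inLoop (i : QInv V) (k : Kat Act Tst) : Option (Kat Act Tst) := some (k ⨟ star (loopBody i))

open Kat in
/-- The code that remains at a program counter. -/
def code (i : QInv V) : PC → Option (Kat Act Tst)
  | start => some (act (.newOffer (tyOf i)) ⨟ star (loopBody i))
  | loop => inLoop i one
  | gotTail => inLoop i (one ⨟ act .readHead ⨟ branchCode i)
  | gotHead => inLoop i (one ⨟ branchCode i)
  | appendGuard => inLoop i ((one ⨟ test (.tType (tyOf i))) ⨟ appendBranch (finishCode i))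
  | append => inLoop i (one ⨟ appendBranch (finishCode i))
  | appendNext =>
      inLoop i (one ⨟ (ntest .tailIsT ⊞
        test .tailIsT ⨟ (ntest .nIsNull ⨟ cas .tailIsT .tailToN ⊞ test .nIsNull ⨟ linkCode i)))
  | appendChecked =>
      inLoop i (one ⨟ (ntest .nIsNull ⨟ cas .tailIsT .tailToN ⊞ test .nIsNull ⨟ linkCode i))
  | tailCas => inLoop i (one ⨟ cas .tailIsT .tailToN)
  | linkCas => inLoop i (one ⨟ linkCode i)
  | linked => inLoop i (one ⨟ cas .tailIsT .tailToOffer ⨟ star (test .offerItemIsArg) ⨟ wakeCode i)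
  | wait => inLoop i (one ⨟ star (test .offerItemIsArg) ⨟ wakeCode i)
  | waiting => inLoop i ((one ⨟ star (test .offerItemIsArg)) ⨟ wakeCode i)
  | woken => inLoop i (one ⨟ act .readHead ⨟ leaveCode i)
  | wokenHead => inLoop i (one ⨟ leaveCode i)
  | headCas => inLoop i ((one ⨟ cas .headIsH .headToOffer) ⨟ finishCode i)
  | finish => inLoop i (one ⨟ finishCode i)
  | swapGuard => inLoop i (one ⨟ ntest (.tType (tyOf i)) ⨟ swapBranch (exchangeCode i))
  | swap => inLoop i (one ⨟ swapBranch (exchangeCode i))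
  | swapNext =>
      inLoop i (one ⨟ (ntest .tailIsT ⊞ test .tailIsT ⨟ (ntest .headIsH ⊞ test .headIsH ⨟
        (test .nIsNull ⊞ ntest .nIsNull ⨟ exchangeCode i))))
  | swapTail =>
      inLoop i (one ⨟ (ntest .headIsH ⊞ test .headIsH ⨟
        (test .nIsNull ⊞ ntest .nIsNull ⨟ exchangeCode i)))
  | swapHead => inLoop i (one ⨟ (test .nIsNull ⊞ ntest .nIsNull ⨟ exchangeCode i))
  | swapReady => inLoop i (one ⨟ exchangeCode i)
  | swapItem =>
      inLoop i (one ⨟ (test .xIsNull ⨟ cas .headIsH .headToN ⊞ ntest .xIsNull ⨟ casNItemCode))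
  | swapCas => inLoop i (one ⨟ casNItemCode)
  | swapped => inLoop i (one ⨟ cas .headIsH .headToN ⨟ ret)
  | missed => inLoop i (one ⨟ cas .headIsH .headToN)
  | atRet => inLoop i (one ⨟ ret)
  | returned => none

/-- The control-flow graph of the queue: the instructions that can be executed at a program counter,
each with the counter it leads to. -/
def edges (i : QInv V) : PC → List (Kat.Instr Act Tst × PC)
  | start => [(.act (.newOffer (tyOf i)), loop)]
  | loop => [(.act .readTail, gotTail)]
  | gotTail => [(.act .readHead, gotHead)]
  | gotHead =>
      [(.test .hIsT true, append), (.test .hIsT false, appendGuard),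
        (.test .hIsT false, swapGuard)]
  | appendGuard => [(.test (.tType (tyOf i)) true, append)]
  | append => [(.act .readTNext, appendNext)]
  | appendNext => [(.test .tailIsT false, loop), (.test .tailIsT true, appendChecked)]
  | appendChecked => [(.test .nIsNull false, tailCas), (.test .nIsNull true, linkCas)]
  | tailCas => [(.arw .tailIsT .tailToN, loop), (.test .tailIsT false, loop)]
  | linkCas => [(.test .tNextIsN false, loop), (.arw .tNextIsN .linkOffer, linked)]
  | linked => [(.arw .tailIsT .tailToOffer, wait), (.test .tailIsT false, wait)]
  | wait | waiting =>
      [(.test .offerItemIsArg true, waiting), (.test .offerItemIsArg false, woken)]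
  | woken => [(.act .readHead, wokenHead)]
  | wokenHead => [(.test .offerIsHNext false, finish), (.test .offerIsHNext true, headCas)]
  | headCas => [(.arw .headIsH .headToOffer, finish), (.test .headIsH false, finish)]
  | finish =>
      match i with
      | .enq _ => [(.ret, returned)]
      | .deq => [(.act .readOfferItem, atRet)]
  | swapGuard => [(.test (.tType (tyOf i)) false, swap)]
  | swap => [(.act .readHNext, swapNext)]
  | swapNext => [(.test .tailIsT false, loop), (.test .tailIsT true, swapTail)]
  | swapTail => [(.test .headIsH false, loop), (.test .headIsH true, swapHead)]
  | swapHead => [(.test .nIsNull true, loop), (.test .nIsNull false, swapReady)]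
  | swapReady =>
      match i with
      | .enq _ => [(.arw .nItemIsNull .putArg, swapped), (.test .nItemIsNull false, missed)]
      | .deq => [(.act .readNItem, swapItem)]
  | swapItem => [(.test .xIsNull true, missed), (.test .xIsNull false, swapCas)]
  | swapCas => [(.arw .nItemIsX .putNull, swapped), (.test .nItemIsX false, missed)]
  | swapped => [(.arw .headIsH .headToN, atRet), (.test .headIsH false, atRet)]
  | missed => [(.arw .headIsH .headToN, loop), (.test .headIsH false, loop)]
  | atRet => [(.ret, returned)]
  | returned => []

theorem linearForm_code {i : QInv V} {pc : PC} {k : Kat Act Tst} (hk : pc.code i = some k) :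
    k.linearForm = (pc.edges i).map fun e => (e.1, e.2.code i) := by
  cases pc
  case returned => cases hk
  all_goals
    obtain rfl := Option.some.inj hk
    cases i <;> rfl

end PC

variable {l l' : Loc V} {g g' : Shared V} {i : QInv V} {k : Kat Act Tst} {pc : PC}
  {ℓ : Label (QInv V) (Option V) Act Tst} {r : Option (Kat Act Tst)}

theorem threadStep_queue_iff (hk : pc.code i = some k) :
    (queue V).ThreadStep l g k ℓ l' g' r ↔
      ∃ ι pc', (ι, pc') ∈ pc.edges i ∧ pc'.code i = r ∧ (queue V).InstrStep l g ι ℓ l' g' := by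
  rw [ConcObject.threadStep_iff, PC.linearForm_code hk]
  constructor
  · rintro ⟨ι, hι, hs⟩
    obtain ⟨⟨ι', pc'⟩, he, heq⟩ := List.mem_map.1 hι
    obtain ⟨rfl, rfl⟩ := Prod.mk.inj heq
    exact ⟨ι', pc', he, rfl, hs⟩
  · rintro ⟨ι, pc', he, rfl, hs⟩
    exact ⟨ι, List.mem_map.2 ⟨_, he, rfl⟩, hs⟩

end SLS

/-! ### Layers of blocks -/

namespace SLS

section Languages

open RegularExpression (char)
open scoped Computability

variable {α β : Type*} {L : Language α} {K : Language β} {f : α → List β} {u v : List α}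

theorem mem_kstar_of_mem (hu : u ∈ L) : u ∈ L∗ :=
  le_kstar (a := L) hu

theorem append_mem_kstar (hu : u ∈ L∗) (hv : v ∈ L∗) : u ++ v ∈ L∗ :=
  kstar_mul_kstar L ▸ Language.append_mem_mul hu hv

theorem flatMap_mem_kstar {l : List β} {f : β → List α} (h : ∀ k ∈ l, f k ∈ L) :
    l.flatMap f ∈ L∗ :=
  Language.mem_kstar.2 ⟨l.map f, List.flatMap_def, by simpa using h⟩

theorem flatMap_mem_kstar_of_mem_kstar (h : ∀ u ∈ L, u.flatMap f ∈ K∗) (hu : u ∈ L∗) :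
    u.flatMap f ∈ K∗ := by
  obtain ⟨l, rfl, hl⟩ := Language.mem_kstar.1 hu
  clear hu
  induction l with
  | nil => exact Language.nil_mem_kstar _
  | cons a l ih =>
    rw [List.flatten_cons, List.flatMap_append]
    exact append_mem_kstar (h a (hl a (by simp))) (ih fun y hy => hl y (by simp [hy]))

theorem ED_mem_matches' : [ED.E, ED.D] ∈ (char ED.E * char ED.D).matches' :=
  ⟨_, rfl, _, rfl, rfl⟩

theorem flatMap_marks_reservationCycle {z : List Layer}
    (hz : z ∈ (char Layer.Eswap * char Layer.HR * char Layer.Dapp * char Layer.TA).matches'∗) :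
    ([Layer.Dapp, Layer.TA] ++ z ++ [Layer.Eswap] ++ [Layer.HR]).flatMap marks ∈
      (char ED.E * char ED.D).matches'∗ := by
  have hzm : z.flatMap marks ∈ (char ED.E * char ED.D).matches'∗ := by
    refine flatMap_mem_kstar_of_mem_kstar ?_ hz
    rintro _ ⟨_, ⟨_, ⟨_, rfl, _, rfl, rfl⟩, _, rfl, rfl⟩, _, rfl, rfl⟩
    exact mem_kstar_of_mem ED_mem_matches'
  simpa [marks] using append_mem_kstar hzm (mem_kstar_of_mem ED_mem_matches')

theorem flatMap_marks_itemCycle {z : List Layer}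
    (hz : z ∈ (char Layer.Dswap * char Layer.HR * char Layer.Eapp * char Layer.TA).matches'∗) :
    ([Layer.Eapp, Layer.TA] ++ z ++ [Layer.Dswap] ++ [Layer.HR]).flatMap marks ∈
      (char ED.E * char ED.D).matches'∗ := by
  obtain ⟨l, rfl, hl⟩ := Language.mem_kstar.1 hz
  clear hz
  induction l with
  | nil => exact mem_kstar_of_mem ED_mem_matches'
  | cons a l ih =>
    have ih := ih fun y hy => hl y (by simp [hy])
    obtain ⟨_, ⟨_, ⟨_, rfl, _, rfl, rfl⟩, _, rfl, rfl⟩, _, rfl, rfl⟩ := hl a (by simp)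
    simpa [marks] using append_mem_kstar (mem_kstar_of_mem ED_mem_matches') ih

theorem flatMap_marks_mem_pointExpr {w : List Layer} (hw : w ∈ layerExpr.matches') :
    w.flatMap marks ∈ pointExpr.matches' := by
  obtain ⟨u, hu, v, hv, rfl⟩ := hw
  simp only [List.flatMap_append]
  refine ⟨_, flatMap_mem_kstar_of_mem_kstar ?_ hu, _, .inl ?_, rfl⟩
  · rintro _ (⟨_, ⟨_, ⟨_, ⟨_, rfl, _, rfl, rfl⟩, z, hz, rfl⟩, _, rfl, rfl⟩, _, rfl, rfl⟩ |
      ⟨_, ⟨_, ⟨_, ⟨_, rfl, _, rfl, rfl⟩, z, hz, rfl⟩, _, rfl, rfl⟩, _, rfl, rfl⟩)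
    exacts [flatMap_marks_reservationCycle hz, flatMap_marks_itemCycle hz]
  · rcases hv with hv | hv <;> refine flatMap_mem_kstar_of_mem_kstar ?_ hv <;>
      rintro _ ⟨_, rfl, _, rfl, rfl⟩
    exacts [Language.nil_mem_kstar _, mem_kstar_of_mem rfl]

end Languages

/-- The layer that appends a node of a given type. -/
def appendLayer : NodeType → Layer
  | .item => .Eapp
  | .reservation => .Dapp

/-- The layer that exchanges the item of a node of a given type. -/
def swapLayer : NodeType → Layer
  | .item => .Dswap
  | .reservation => .Eswap

theorem appendLayer_tailSide (ty : NodeType) : (appendLayer ty).TailSide := by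
  cases ty <;> trivial

theorem swapLayer_headSide (ty : NodeType) : (swapLayer ty).HeadSide := by
  cases ty <;> trivial

/-- The layers for the `k`-th appended node, when the tail, the exchanges and the head have
passed `tl`, `sw` and `hd` appended nodes. -/
def blockLayers (ty : NodeType) (tl sw hd k : ℕ) : List Layer :=
  appendLayer ty :: ((if k < tl then [.TA] else []) ++ (if k < sw then [swapLayer ty] else []) ++
    (if k < hd then [.HR] else []))

section BlockLayers

variable {ty : NodeType} {tl sw hd k : ℕ}

theorem mem_blockLayers {y : Layer} : y ∈ blockLayers ty tl sw hd k ↔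
    y = appendLayer ty ∨ k < tl ∧ y = .TA ∨ k < sw ∧ y = swapLayer ty ∨ k < hd ∧ y = .HR := by
  simp only [blockLayers, List.mem_cons, List.mem_append]
  grind

theorem blockLayers_of_lt (htl : k < tl) (hsw : k < sw) (hhd : k < hd) :
    blockLayers ty tl sw hd k = [appendLayer ty, .TA, swapLayer ty, .HR] := by
  simp [blockLayers, htl, hsw, hhd]

theorem blockLayers_of_le (htl : k < tl) (hsw : sw ≤ k) (hhd : hd ≤ k) :
    blockLayers ty tl sw hd k = [appendLayer ty, .TA] := by
  simp [blockLayers, htl, hsw.not_gt, hhd.not_gt]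

theorem blockLayers_eq_singleton (htl : tl ≤ k) (hsw : sw ≤ k) (hhd : hd ≤ k) :
    blockLayers ty tl sw hd k = [appendLayer ty] := by
  simp [blockLayers, htl.not_gt, hsw.not_gt, hhd.not_gt]

theorem blockLayers_congr {tl' sw' hd' : ℕ} (htl : k < tl' ↔ k < tl) (hsw : k < sw' ↔ k < sw)
    (hhd : k < hd' ↔ k < hd) : blockLayers ty tl' sw' hd' k = blockLayers ty tl sw hd k := by
  simp only [blockLayers, htl, hsw, hhd]

theorem blockLayers_succ_tail (hsw : sw ≤ tl) (hhd : hd ≤ tl) :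
    blockLayers ty (tl + 1) sw hd tl = blockLayers ty tl sw hd tl ++ [.TA] := by
  simp [blockLayers, hsw.not_gt, hhd.not_gt]

theorem blockLayers_succ_swaps (hhd : hd ≤ sw) :
    blockLayers ty tl (sw + 1) hd sw = blockLayers ty tl sw hd sw ++ [swapLayer ty] := by
  simp [blockLayers, hhd.not_gt]

theorem blockLayers_succ_head :
    blockLayers ty tl sw (hd + 1) hd = blockLayers ty tl sw hd hd ++ [.HR] := by
  simp [blockLayers]

theorem flatMap_blockLayers_mem_layerExpr {ty : ℕ → NodeType} {m : ℕ} (h : sw ≤ m)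
    (hty : ∀ j k, sw ≤ j → j < m → sw ≤ k → k < m → ty j = ty k) :
    (List.range m).flatMap (fun k => blockLayers (ty k) m sw sw k) ∈ layerExpr.matches' := by
  obtain ⟨d, rfl⟩ := Nat.exists_eq_add_of_le h
  rw [List.range_add, List.flatMap_append, List.flatMap_map]
  refine ⟨_, flatMap_mem_kstar fun k hk => ?_, _, ?_, rfl⟩
  · have hk : k < sw := List.mem_range.1 hk
    rw [blockLayers_of_lt (hk.trans_le h) hk hk]
    cases ty k
    exacts [
      .inr ⟨_, ⟨_, ⟨_, ⟨_, rfl, _, rfl, rfl⟩, [], Language.nil_mem_kstar _, rfl⟩, _, rfl, rfl⟩,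
        _, rfl, rfl⟩,
      .inl ⟨_, ⟨_, ⟨_, ⟨_, rfl, _, rfl, rfl⟩, [], Language.nil_mem_kstar _, rfl⟩, _, rfl, rfl⟩,
        _, rfl, rfl⟩]
  · have pending : ∀ k ∈ List.range d, blockLayers (ty (sw + k)) (sw + d) sw sw (sw + k) =
        [appendLayer (ty sw), .TA] := fun k hk => by
      have hk : k < d := List.mem_range.1 hk
      rw [hty (sw + k) sw (by omega) (by omega) le_rfl (by omega),
        blockLayers_of_le (by omega) (by omega) (by omega)]
    cases hs : ty sw
    · refine .inr (flatMap_mem_kstar fun k hk => ?_)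
      rw [pending k hk, hs]
      exact ⟨_, rfl, _, rfl, rfl⟩
    · refine .inl (flatMap_mem_kstar fun k hk => ?_)
      rw [pending k hk, hs]
      exact ⟨_, rfl, _, rfl, rfl⟩

end BlockLayers

section Exchange

open Relation (ReflTransGen)

variable {T : Type*} {u v : List (T × Layer)} {y : T × Layer}

theorem Exchange.append_right (h : Exchange u v) (z : List (T × Layer)) :
    Exchange (u ++ z) (v ++ z) := by
  obtain ⟨u, v, x, y, hne, hx, hy⟩ := h
  simpa using Exchange.mk u (v ++ z) x y hne hx hy

theorem exchanges_append_right (h : ReflTransGen Exchange u v) (z : List (T × Layer)) :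
    ReflTransGen Exchange (u ++ z) (v ++ z) :=
  h.lift (· ++ z) fun _ _ h => h.append_right z

theorem exchanges_append_comm (u : List (T × Layer))
    (h : ∀ x ∈ v, x.1 ≠ y.1 ∧ x.2.TailSide ∧ y.2.HeadSide) :
    ReflTransGen Exchange (u ++ v ++ [y]) (u ++ [y] ++ v) := by
  induction v generalizing u with
  | nil => simpa using ReflTransGen.refl
  | cons x v ih =>
    have hv := ih (u ++ [x]) fun z hz => h z (by simp [hz])
    obtain ⟨hne, hx, hy⟩ := h x (by simp)
    have hxy := Exchange.mk u v x y hne hx hy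
    simp only [List.append_assoc, List.cons_append, List.nil_append] at hv ⊢
    exact hv.tail hxy

theorem exchanges_insert {W : ℕ → List (T × Layer)} {k m : ℕ} (hk : k < m)
    (h : ∀ j, k < j → j < m → ∀ x ∈ W j, x.1 ≠ y.1 ∧ x.2.TailSide ∧ y.2.HeadSide) :
    ReflTransGen Exchange ((List.range m).flatMap W ++ [y])
      ((List.range m).flatMap (Function.update W k (W k ++ [y]))) := by
  induction m with
  | zero => omega
  | succ m ih =>
    simp only [List.range_succ, List.flatMap_append, List.flatMap_singleton]
    rcases Nat.lt_succ_iff_lt_or_eq.1 hk with hkm | rfl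
    · have hlast := exchanges_append_comm ((List.range m).flatMap W) (h m hkm (by omega))
      have hinit := exchanges_append_right (ih hkm fun j hj hjm => h j hj (by omega)) (W m)
      rw [Function.update_of_ne hkm.ne']
      exact hlast.trans hinit
    · have hinit : (List.range k).flatMap (Function.update W k (W k ++ [y])) =
          (List.range k).flatMap W :=
        List.flatMap_congr fun j hj => Function.update_of_ne (List.mem_range.1 hj).ne _ _
      rw [hinit, Function.update_self, ← List.append_assoc]

end Exchange

section Writes

variable {V T : Type*} {env : T → Option (QInv V)} {t : T} {i : QInv V}
  {τ : List (T × Label (QInv V) (Option V) Act Tst)} {ℓ : Label (QInv V) (Option V) Act Tst}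

theorem writes_append_of_some {y : Layer} (hi : env t = some i) (hy : layerOf i ℓ = some y) :
    writes env (τ ++ [(t, ℓ)]) = writes env τ ++ [(t, y)] := by
  simp [writes, hi, hy]

theorem writes_append_of_none (hi : env t = some i) (hy : layerOf i ℓ = none) :
    writes env (τ ++ [(t, ℓ)]) = writes env τ := by
  simp [writes, hi, hy]

end Writes

end SLS

/-! ### The history of a configuration -/

namespace SLS

theorem argOf_ne_argOf {V : Type*} {i j : QInv V} (h : tyOf i ≠ tyOf j) : argOf i ≠ argOf j := by
  cases i <;> cases j <;> simp_all [tyOf, argOf]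

theorem argOf_eq_none {V : Type*} {i : QInv V} (h : tyOf i ≠ .item) : argOf i = none := by
  cases i with
  | enq => exact absurd rfl h
  | deq => rfl

theorem argOf_ne_none {V : Type*} {i : QInv V} (h : tyOf i ≠ .reservation) : argOf i ≠ none := by
  cases i with
  | enq v => exact Option.some_ne_none v
  | deq => exact absurd rfl h

/-- The part that a thread plays in the list: none yet, appending the node of block `k`, or
exchanging the item of that node. -/
inductive Role where
  | free
  | app (k : ℕ)
  | swp (k : ℕ)

/-- The thread takes part in block `k`. -/
def Role.IsIn (r : Role) (k : ℕ) : Prop := r = .app k ∨ r = .swp k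

/-- The history of a configuration, from which the writes and the operations of the trace can be
read off block by block. The nodes ever appended to the list have, with the dummy node, the
addresses `address 0, …, address len`; block `k` is about the node `address (k + 1)`. The tail and
the head point to the nodes number `tail` and `head`, and the items of the blocks below `swaps` have
been exchanged. For block `k`, `op k` is the invocation that appended the node, `writes k` are the
writes for it, `ops k` are the operations to be linearized together, and `pos k` is the position of
the exchange in the trace. Every allocated node other than the dummy node has an owner. -/
structure History (V T : Type*) where
  address : ℕ → ℕ
  len : ℕ
  tail : ℕ
  swaps : ℕ
  head : ℕ
  role : T → Role
  owner : ℕ → Option T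
  op : ℕ → QInv V
  writes : ℕ → List (T × Layer)
  ops : ℕ → List (T × QInv V × Option V)
  pos : ℕ → ℕ

variable {V T : Type*}

/-- The type of the node number `p`; the dummy node has number `0`. -/
def History.type (H : History V T) : ℕ → NodeType
  | 0 => .item
  | k + 1 => tyOf (H.op k)

/-- The shared memory agrees with the history. -/
structure MemInv (H : History V T) (g : Shared V) : Prop where
  bounds : H.head ≤ H.swaps ∧ H.swaps ≤ H.head + 1 ∧ H.swaps ≤ H.tail ∧ H.tail ≤ H.len ∧
    H.len ≤ H.tail + 1
  head_eq : g.head = H.address H.head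
  tail_eq : g.tail = H.address H.tail
  lt_size : ∀ k ≤ H.len, H.address k < g.size
  inj : ∀ j ≤ H.len, ∀ k ≤ H.len, H.address j = H.address k → j = k
  next : ∀ k < H.len, (g.node (H.address k)).next = some (H.address (k + 1))
  last : (g.node (H.address H.len)).next = none
  type : ∀ k ≤ H.len, (g.node (H.address k)).type = H.type k
  same : ∀ j k, H.head ≤ j → j < H.len → H.head ≤ k → k < H.len → tyOf (H.op j) = tyOf (H.op k)
  item : ∀ k, H.swaps ≤ k → k < H.len → (g.node (H.address (k + 1))).item = argOf (H.op k)
  app : ∀ t k, H.role t = .app k → k < H.len ∧ H.owner (H.address (k + 1)) = some t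
  swp : ∀ t k, H.role t = .swp k → k < H.swaps

/-- The operations linearized for a node whose item has not been exchanged. -/
def pendingOps (t : T) : QInv V → List (T × QInv V × Option V)
  | .enq v => [(t, .enq v, none)]
  | .deq => []

/-- The value that an invocation receives from an invocation of the other kind. -/
def received : QInv V → QInv V → Option V
  | .enq _, _ => none
  | .deq, j => argOf j

/-- The operations linearized for an exchange between the invocations of `t` and `u`. -/
def rendezvous (t u : T) (i j : QInv V) : List (T × QInv V × Option V) :=
  match i with
  | .enq _ => [(t, i, received i j), (u, j, received j i)]
  | .deq => [(u, j, received j i), (t, i, received i j)]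

theorem mem_rendezvous {t u : T} {i j : QInv V} {x : T × QInv V × Option V} :
    x ∈ rendezvous t u i j ↔ x = (t, i, received i j) ∨ x = (u, j, received j i) := by
  cases i <;> simp [rendezvous, or_comm]

/-- The threads and operations of block `k`: either the item of its node has not been exchanged, or
a thread with an invocation of the other kind has left its argument there. -/
inductive Block (env : T → Option (QInv V)) (H : History V T) (g : Shared V) (k : ℕ) : Prop
  | pending (t : T) : H.swaps ≤ k → H.role t = .app k → env t = some (H.op k) →
      H.ops k = pendingOps t (H.op k) → Block env H g k
  | exchanged (t u : T) (j : QInv V) : k < H.swaps → H.role t = .app k → env t = some (H.op k) →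
      H.role u = .swp k → env u = some j → tyOf (H.op k) ≠ tyOf j →
      (g.node (H.address (k + 1))).item = argOf j → H.ops k = rendezvous t u (H.op k) j →
      Block env H g k

/-- Thread `t` may perform tail-side writes for block `k`. The condition ensures that it does not
perform head-side writes for earlier blocks later on. -/
def MayWrite (env : T → Option (QInv V)) (H : History V T) (t : T) (k : ℕ) : Prop :=
  (∀ j, H.role t = .app j → k ≤ j) ∧
    (H.role t = .app k ∨ (∃ i, env t = some i ∧ H.type k = tyOf i) ∨ k ≤ H.head)

/-- The writes of block `k` are those due so far, and each is by a thread allowed to perform it. -/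
structure BlockWrites (env : T → Option (QInv V)) (H : History V T) (k : ℕ) : Prop where
  letters : (H.writes k).map Prod.snd = blockLayers (H.type (k + 1)) H.tail H.swaps H.head k
  writer : ∀ x ∈ H.writes k, x.2.TailSide → MayWrite env H x.1 k

section Basic

variable {env : T → Option (QInv V)} {H : History V T} {g : Shared V} {t u : T} {k p : ℕ}

theorem MemInv.app_inj (hm : MemInv H g) (ht : H.role t = .app k) (hu : H.role u = .app k) :
    t = u :=
  Option.some.inj ((hm.app t k ht).2.symm.trans (hm.app u k hu).2)

theorem Block.op_eq (hb : Block env H g k) (hm : MemInv H g) (ht : H.role t = .app k) {i : QInv V}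
    (hi : env t = some i) : H.op k = i := by
  cases hb with
  | pending t' _ ht' hi' | exchanged t' _ _ _ ht' hi' =>
    obtain rfl := hm.app_inj ht ht'
    exact Option.some.inj (hi'.symm.trans hi)

theorem MemInv.tail_eq_iff (hm : MemInv H g) (hp : p ≤ H.len) :
    g.tail = H.address p ↔ H.tail = p := by
  rw [hm.tail_eq]
  exact ⟨hm.inj _ hm.bounds.2.2.2.1 _ hp, congrArg _⟩

theorem MemInv.head_eq_iff (hm : MemInv H g) (hp : p ≤ H.len) :
    g.head = H.address p ↔ H.head = p := by
  have := hm.bounds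
  rw [hm.head_eq]
  exact ⟨hm.inj _ (by omega) _ hp, congrArg _⟩

theorem MemInv.next_eq_none_or (hm : MemInv H g) (hp : p ≤ H.len) :
    (g.node (H.address p)).next = none ∧ p = H.len ∨
      (g.node (H.address p)).next = some (H.address (p + 1)) ∧ p < H.len := by
  rcases hp.lt_or_eq with hp | rfl
  exacts [.inr ⟨hm.next p hp, hp⟩, .inl ⟨hm.last, rfl⟩]

theorem MemInv.item_eq_iff (hm : MemInv H g) (hb : Block env H g k) (hk : k < H.len) :
    (g.node (H.address (k + 1))).item = argOf (H.op k) ↔ H.swaps ≤ k := by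
  refine ⟨fun h => ?_, fun h => hm.item k h hk⟩
  cases hb with
  | pending _ h => exact h
  | exchanged _ _ _ _ _ _ _ _ hty hitem => exact absurd (h.symm.trans hitem) (argOf_ne_argOf hty)

theorem MemInv.item_eq_or (hm : MemInv H g) (hb : Block env H g k) (hk : k < H.len)
    (hty : tyOf (H.op k) ≠ .reservation) : (g.node (H.address (k + 1))).item = none ∧ k < H.swaps ∨
      (g.node (H.address (k + 1))).item = argOf (H.op k) ∧ argOf (H.op k) ≠ none := by
  have hnull := argOf_ne_none hty
  cases hb with
  | pending _ hsw => exact .inr ⟨hm.item k hsw hk, hnull⟩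
  | exchanged _ _ j hsw _ _ _ _ hne hitem =>
    refine .inl ⟨hitem.trans (argOf_eq_none fun hj => hne ?_), hsw⟩
    cases hop : H.op k with
    | enq => exact hj.symm
    | deq => exact absurd (congrArg tyOf hop) hty

end Basic

end SLS

/-! ### The knowledge of a thread -/

namespace SLS

variable {V T : Type*}

/-- The own node at address `o` of a thread executing `i` has been allocated and not been
appended. -/
structure Fresh (H : History V T) (g : Shared V) (i : QInv V) (t : T) (o : ℕ) : Prop where
  role : H.role t = .free
  owner : H.owner o = some t
  lt_size : o < g.size
  ne_address : ∀ k ≤ H.len, H.address k ≠ o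
  node : g.node o = ⟨argOf i, tyOf i, none⟩

/-- What a thread executing `i` knows in the main loop, up to its first successful write, where `p`
and `q` are the numbers of the nodes in its variables `t` and `h`. -/
def Seeking (H : History V T) (i : QInv V) (l : Loc V) (p q : ℕ) : PC → Prop
  | .loop => True
  | .gotTail => p ≤ H.tail ∧ l.t = H.address p
  | .gotHead | .appendGuard =>
      p ≤ H.tail ∧ l.t = H.address p ∧ q ≤ H.head ∧ l.h = H.address q
  | .append => p ≤ H.tail ∧ l.t = H.address p ∧ (H.type p = tyOf i ∨ p ≤ H.head)
  | .appendNext | .appendChecked =>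
      p ≤ H.tail ∧ l.t = H.address p ∧ (H.type p = tyOf i ∨ p ≤ H.head) ∧
        (l.n = none ∨ p < H.len ∧ l.n = some (H.address (p + 1)))
  | .tailCas =>
      p ≤ H.tail ∧ l.t = H.address p ∧ (H.type p = tyOf i ∨ p ≤ H.head) ∧
        p < H.len ∧ l.n = some (H.address (p + 1))
  | .linkCas =>
      p ≤ H.tail ∧ l.t = H.address p ∧ (H.type p = tyOf i ∨ p ≤ H.head) ∧ l.n = none
  | .swapGuard =>
      p ≤ H.tail ∧ l.t = H.address p ∧ q ≤ H.head ∧ l.h = H.address q ∧ p ≠ q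
  | .swap =>
      p ≤ H.tail ∧ l.t = H.address p ∧ H.type p ≠ tyOf i ∧ q ≤ H.head ∧ l.h = H.address q ∧ p ≠ q
  | .swapNext =>
      p ≤ H.tail ∧ l.t = H.address p ∧ H.type p ≠ tyOf i ∧ q ≤ H.head ∧ l.h = H.address q ∧
        p ≠ q ∧ (l.n = none ∨ q < H.len ∧ l.n = some (H.address (q + 1)))
  | .swapTail =>
      p ≤ H.tail ∧ H.type p ≠ tyOf i ∧ q ≤ H.head ∧ l.h = H.address q ∧ q < p ∧
        (l.n = none ∨ l.n = some (H.address (q + 1)))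
  | .swapHead =>
      q ≤ H.head ∧ q < H.tail ∧ l.h = H.address q ∧ tyOf (H.op q) ≠ tyOf i ∧
        (l.n = none ∨ l.n = some (H.address (q + 1)))
  | .swapReady =>
      q ≤ H.head ∧ q < H.tail ∧ l.h = H.address q ∧ tyOf (H.op q) ≠ tyOf i ∧
        l.n = some (H.address (q + 1))
  | .swapItem =>
      q ≤ H.head ∧ q < H.tail ∧ l.h = H.address q ∧ tyOf (H.op q) ≠ tyOf i ∧
        l.n = some (H.address (q + 1)) ∧ i = .deq ∧ (l.x = none → q < H.swaps) ∧
          (l.x ≠ none → l.x = argOf (H.op q))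
  | .swapCas =>
      q ≤ H.head ∧ q < H.tail ∧ l.h = H.address q ∧ tyOf (H.op q) ≠ tyOf i ∧
        l.n = some (H.address (q + 1)) ∧ i = .deq ∧ l.x = argOf (H.op q)
  | .missed =>
      q < H.swaps ∧ l.h = H.address q ∧ tyOf (H.op q) ≠ tyOf i ∧ l.n = some (H.address (q + 1))
  | _ => False

/-- What a thread knows after appending the node of block `k`, where `q` is the number of the node
in its variable `h`. -/
def Appended (H : History V T) (l : Loc V) (k q : ℕ) : PC → Prop
  | .linked => l.t = H.address k
  | .wait | .waiting => k < H.tail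
  | .woken | .finish => k < H.swaps
  | .wokenHead => k < H.swaps ∧ q ≤ H.head ∧ l.h = H.address q
  | .headCas => k < H.swaps ∧ l.h = H.address k
  | _ => False

/-- The operation of `t` has taken part in the exchange of a block, and `t` will not write any
more. -/
def Served (H : History V T) (i : QInv V) (t : T) (l : Loc V) : Prop :=
  ∃ k < H.swaps, (t, i, l.x) ∈ H.ops k ∧ (H.role t = .app k ∨ H.role t = .swp k ∧ k < H.head)

/-- What is known when thread `t`, executing `i`, is at a program counter. -/
inductive At (H : History V T) (g : Shared V) (i : QInv V) (t : T) (l : Loc V) : PC → Prop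
  | start : H.role t = .free → At H g i t l .start
  | seeking {pc} (p q : ℕ) : Fresh H g i t l.offer → Seeking H i l p q pc → At H g i t l pc
  | appended {pc} (k q : ℕ) : H.role t = .app k → l.offer = H.address (k + 1) →
      Appended H l k q pc → At H g i t l pc
  | swapped (k : ℕ) : k < H.swaps → H.role t = .swp k → l.h = H.address k →
      l.n = some (H.address (k + 1)) → tyOf (H.op k) ≠ tyOf i → (t, i, l.x) ∈ H.ops k →
      At H g i t l .swapped
  | atRet : Served H i t l → At H g i t l .atRet
  | returned : Served H i t l → At H g i t l .returned

/-- What is known about a thread that executes `i` and is at a program counter. -/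
structure ThreadAt (env : T → Option (QInv V)) (H : History V T) (g : Shared V) (t : T)
    (i : QInv V) (l : Loc V) (pc : PC) : Prop where
  env_eq : env t = some i
  arg : l.arg = argOf i
  x_eq : i ≠ .deq → l.x = none
  at_pc : At H g i t l pc

/-- The history has been continued. -/
structure Continues (H H' : History V T) : Prop where
  len : H.len ≤ H'.len
  tail : H.tail ≤ H'.tail
  swaps : H.swaps ≤ H'.swaps
  head : H.head ≤ H'.head
  address : ∀ k ≤ H.len, H'.address k = H.address k
  op : ∀ k < H.len, H'.op k = H.op k
  ops : ∀ k < H.swaps, H'.ops k = H.ops k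

/-- A step has continued the history without interfering with the other threads than `t`. -/
structure StepOf (t : T) (H H' : History V T) (g g' : Shared V) : Prop where
  continues : Continues H H'
  role : ∀ u ≠ t, H'.role u = H.role u
  fresh : ∀ u ≠ t, ∀ i o, Fresh H g i u o → Fresh H' g' i u o

section Edges

variable {i : QInv V} {l : Loc V} {g : Shared V} {pc pc' : PC} {a : Act} {b : Tst}

theorem actSem_of_mem_edges (he : (.act a, pc') ∈ pc.edges i) (hpc : pc ≠ .start) :
    (actSem a l g).2 = g ∧ (actSem a l g).1.offer = l.offer ∧ (actSem a l g).1.arg = l.arg ∧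
      (i ≠ .deq → (actSem a l g).1.x = l.x) := by
  cases pc <;> cases i <;>
    simp only [PC.edges, List.mem_cons, List.not_mem_nil, Prod.mk.injEq, reduceCtorEq,
      Kat.Instr.act.injEq, false_and, or_false] at he <;>
    first | contradiction | (obtain ⟨rfl, -⟩ := he; simp [actSem])

theorem actSem_fst_of_mem_edges (he : (.arw b a, pc') ∈ pc.edges i) : (actSem a l g).1 = l := by
  cases pc <;> cases i <;>
    simp only [PC.edges, List.mem_cons, List.not_mem_nil, Prod.mk.injEq, reduceCtorEq,
      Kat.Instr.arw.injEq, false_and, or_false, false_or] at he <;>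
    (obtain ⟨⟨-, rfl⟩, -⟩ := he; rfl)

end Edges

section Stability

variable {env : T → Option (QInv V)} {H H' : History V T} {g g' : Shared V} {i : QInv V} {t u : T}
  {l : Loc V} {pc : PC} {k p q : ℕ}

theorem Continues.type (h : Continues H H') (hp : p ≤ H.len) : H'.type p = H.type p := by
  cases p with
  | zero => rfl
  | succ p => rw [History.type, History.type, h.op p hp]

theorem Seeking.mono (hs : Seeking H i l p q pc) (hm : MemInv H g) (h : Continues H H') :
    Seeking H' i l p q pc := by
  have := hm.bounds
  have hty := @Continues.type _ _ _ _ p h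
  obtain ⟨hlen, htail, hswaps, hhead, haddress, hop, -⟩ := h
  cases pc <;> simp only [Seeking] at hs ⊢ <;> grind

theorem Appended.mono (ha : Appended H l k q pc) (hm : MemInv H g) (hk : k < H.len)
    (h : Continues H H') : Appended H' l k q pc := by
  have := hm.bounds
  obtain ⟨-, htail, hswaps, hhead, haddress, -, -⟩ := h
  cases pc <;> simp only [Appended] at ha ⊢ <;> grind

theorem At.of_stepOf (ha : At H g i u l pc) (hm : MemInv H g) (h : StepOf t H H' g g')
    (hu : u ≠ t) : At H' g' i u l pc := by
  have hbounds := hm.bounds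
  have hrole := h.role u hu
  have served : Served H i u l → Served H' i u l := fun ⟨k, hk, hops, hr⟩ =>
    ⟨k, hk.trans_le h.continues.swaps, by rwa [h.continues.ops k hk],
      by rw [hrole]; exact hr.imp_right fun ⟨hr, hk⟩ => ⟨hr, hk.trans_le h.continues.head⟩⟩
  cases ha with
  | start hr => exact .start (hrole.trans hr)
  | seeking p q hf hs => exact .seeking p q (h.fresh u hu i _ hf) (hs.mono hm h.continues)
  | appended k q hr ho ha =>
    have hk := (hm.app u k hr).1
    exact .appended k q (hrole.trans hr) (by rw [ho, h.continues.address _ hk])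
      (ha.mono hm hk h.continues)
  | swapped k hk hr hh hn hty hops =>
    exact .swapped k (hk.trans_le h.continues.swaps) (hrole.trans hr)
      (by rw [hh, h.continues.address k (by omega)])
      (by rw [hn, h.continues.address (k + 1) (by omega)])
      (by rwa [h.continues.op k (by omega)]) (by rwa [h.continues.ops k hk])
  | atRet hs => exact .atRet (served hs)
  | returned hs => exact .returned (served hs)

end Stability

section LocalSteps

variable {env : T → Option (QInv V)} {H : History V T} {g : Shared V} {i : QInv V} {t : T}
  {l : Loc V} {pc pc' : PC} {k p q : ℕ} {a : Act} {b : Tst} {o : Bool}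

theorem Seeking.test (hs : Seeking H i l p q pc) (hm : MemInv H g)
    (hb : ∀ k < H.len, Block env H g k) (he : (.test b o, pc') ∈ pc.edges i)
    (ho : testSem b l g ↔ o = true) :
    Seeking H i l p q pc' := by
  have hbounds := hm.bounds
  have hinj : p ≤ H.len → q ≤ H.len → H.address p = H.address q → p = q :=
    fun hp hq => hm.inj p hp q hq
  have htype : p ≤ H.len → (g.node (H.address p)).type = H.type p := hm.type p
  have htail : p ≤ H.len → (g.tail = H.address p ↔ H.tail = p) := hm.tail_eq_iff
  have hhead : q ≤ H.len → (g.head = H.address q ↔ H.head = q) := hm.head_eq_iff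
  have hitem : q < H.len → ((g.node (H.address (q + 1))).item = argOf (H.op q) ↔ H.swaps ≤ q) :=
    fun hq => hm.item_eq_iff (hb q hq) hq
  have hnull : tyOf (H.op q) ≠ .item → argOf (H.op q) = none := argOf_eq_none
  have hsame : H.head ≤ q → q < p → p ≤ H.len → H.type p = tyOf (H.op q) := fun hq hqp hp => by
    cases p with
    | zero => omega
    | succ p => exact hm.same p q (by omega) (by omega) (by omega) (by omega)
  cases pc <;> cases i <;>
    simp only [Seeking, PC.edges, List.mem_cons, List.not_mem_nil, Prod.mk.injEq,
      Kat.Instr.test.injEq, reduceCtorEq, false_and, or_false] at hs he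
  all_goals grind only [Seeking, testSem, tyOf, argOf, addr, Option.getD_some]

theorem Seeking.act (hs : Seeking H i l p q pc) (hm : MemInv H g)
    (hb : ∀ k < H.len, Block env H g k) (he : (.act a, pc') ∈ pc.edges i) :
    ∃ p' q', Seeking H i (actSem a l g).1 p' q' pc' := by
  have hbounds := hm.bounds
  have hnext {p : ℕ} (hp : p ≤ H.len) : (g.node (H.address p)).next = none ∨
      p < H.len ∧ (g.node (H.address p)).next = some (H.address (p + 1)) :=
    (hm.next_eq_none_or hp).imp And.left And.symm
  have hitem (hq : q < H.len) (hty : tyOf (H.op q) ≠ .reservation) :=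
    hm.item_eq_or (hb q hq) hq hty
  cases pc <;> cases i <;>
    simp only [Seeking, PC.edges, List.mem_cons, List.not_mem_nil, Prod.mk.injEq,
      Kat.Instr.act.injEq, reduceCtorEq, false_and, or_false] at hs he
  all_goals
    obtain ⟨rfl, rfl⟩ := he
  case loop.enq | loop.deq => exact ⟨H.tail, 0, le_rfl, hm.tail_eq⟩
  case gotTail.enq | gotTail.deq => exact ⟨p, H.head, hs.1, hs.2, le_rfl, hm.head_eq⟩
  all_goals
    refine ⟨p, q, ?_⟩
    grind (splits := 20) only [Seeking, actSem, tyOf, argOf, addr, Option.getD_some, cases QInv]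

theorem Appended.test (ha : Appended H l k q pc) (hm : MemInv H g) (hb : Block env H g k)
    (hk : k < H.len) (hoffer : l.offer = H.address (k + 1)) (harg : l.arg = argOf (H.op k))
    (he : (.test b o, pc') ∈ pc.edges i) (ho : testSem b l g ↔ o = true) :
    Appended H l k q pc' := by
  have hbounds := hm.bounds
  have htail : g.tail = H.address k ↔ H.tail = k := hm.tail_eq_iff hk.le
  have hitem : (g.node (H.address (k + 1))).item = argOf (H.op k) ↔ H.swaps ≤ k :=
    hm.item_eq_iff hb hk
  have hnext : q ≤ H.head → (g.node (H.address q)).next = some (H.address (k + 1)) → q = k :=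
    fun hq h => by
      rcases hm.next_eq_none_or (p := q) (by omega) with ⟨h', -⟩ | ⟨h', hq⟩
      · exact absurd (h'.symm.trans h) (by simp)
      · exact Nat.succ_injective (hm.inj _ hq _ hk (Option.some.inj (h'.symm.trans h)))
  cases pc <;> cases i <;>
    simp only [Appended, PC.edges, List.mem_cons, List.not_mem_nil, Prod.mk.injEq,
      Kat.Instr.test.injEq, reduceCtorEq, false_and, or_false] at ha he
  all_goals grind only [Appended, testSem]

theorem Block.served (hb : Block env H g k) (hm : MemInv H g) (hk : k < H.swaps)
    (hr : H.role t = .app k) (hi : env t = some i)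
    (hx : i ≠ .deq → l.x = none) (hdeq : i = .deq → l.x = (g.node (H.address (k + 1))).item) :
    Served H i t l := by
  cases hb with
  | pending _ hsw => exact absurd hk hsw.not_gt
  | exchanged t' u j _ ht htenv _ _ _ hitem hops =>
    obtain rfl := hm.app_inj hr ht
    obtain rfl := Option.some.inj (hi.symm.trans htenv)
    refine ⟨k, hk, ?_, .inl hr⟩
    rw [hops, mem_rendezvous]
    left
    cases hop : H.op k with
    | enq v => rw [hx (by simp [hop]), received]
    | deq => rw [hdeq hop, hitem, received]

theorem At.test (ha : At H g i t l pc) (hm : MemInv H g) (hb : ∀ k < H.len, Block env H g k)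
    (hi : env t = some i) (harg : l.arg = argOf i) (he : (.test b o, pc') ∈ pc.edges i)
    (ho : testSem b l g ↔ o = true) : At H g i t l pc' := by
  cases ha with
  | start | atRet | returned => simp [PC.edges] at he
  | seeking p q hf hs => exact .seeking p q hf (hs.test hm hb he ho)
  | appended k q hr hoffer ha =>
    have hk := (hm.app t k hr).1
    refine .appended k q hr hoffer (ha.test hm (hb k hk) hk hoffer ?_ he ho)
    rw [harg, (hb k hk).op_eq hm hr hi]
  | swapped k hk hr hh _ _ hops =>
    have hbounds := hm.bounds
    obtain ⟨⟨rfl, rfl⟩, rfl⟩ : (b = .headIsH ∧ o = false) ∧ pc' = .atRet := by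
      simpa [PC.edges] using he
    have hhead : H.head ≠ k := fun h =>
      absurd (ho.1 ((hm.head_eq_iff (by omega)).2 h |>.trans hh.symm)) Bool.false_ne_true
    exact .atRet ⟨k, hk, hops, .inr ⟨hr, by omega⟩⟩

theorem At.act (ha : At H g i t l pc) (hm : MemInv H g) (hb : ∀ k < H.len, Block env H g k)
    (hi : env t = some i) (hpc : pc ≠ .start) (he : (.act a, pc') ∈ pc.edges i) :
    At H g i t (actSem a l g).1 pc' := by
  cases ha with
  | start => exact absurd rfl hpc
  | atRet | returned | swapped => simp [PC.edges] at he
  | seeking p q hf hs =>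
    obtain ⟨p', q', hs'⟩ := hs.act hm hb he
    exact .seeking p' q' ((actSem_of_mem_edges he hpc).2.1.symm ▸ hf) hs'
  | appended k q hr hoffer ha =>
    have hk := (hm.app t k hr).1
    cases pc <;> try contradiction
    all_goals
      cases i <;>
        simp only [PC.edges, List.mem_cons, List.not_mem_nil, Prod.mk.injEq, Kat.Instr.act.injEq,
          reduceCtorEq, false_and, or_false] at he
    case woken.enq | woken.deq =>
      obtain ⟨rfl, rfl⟩ := he
      exact .appended k H.head hr hoffer ⟨ha, le_rfl, hm.head_eq⟩
    case finish.deq =>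
      obtain ⟨rfl, rfl⟩ := he
      exact .atRet ((hb k hk).served hm ha hr hi (fun h => absurd rfl h) fun _ => by
        simp [actSem, hoffer])

theorem At.ret (ha : At H g i t l pc) (hm : MemInv H g) (hb : ∀ k < H.len, Block env H g k)
    (hi : env t = some i) (hx : i ≠ .deq → l.x = none) (he : (.ret, pc') ∈ pc.edges i) :
    Served H i t l ∧ pc' = .returned := by
  cases ha with
  | start | returned | swapped => simp [PC.edges] at he
  | seeking _ _ _ hs =>
    cases pc <;> cases i <;> simp [PC.edges, Seeking] at he hs
  | appended k q hr hoffer ha =>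
    have hk := (hm.app t k hr).1
    cases pc <;> cases i <;>
      simp only [Appended, PC.edges, List.mem_cons, List.not_mem_nil, Prod.mk.injEq, reduceCtorEq,
        true_and, false_and, or_false] at ha he
    case finish.enq v =>
      exact ⟨(hb k hk).served hm ha hr hi hx (by simp), he⟩
  | atRet hs => exact ⟨hs, by simpa [PC.edges] using he⟩

end LocalSteps

end SLS

/-! ### The effect of the writes -/

namespace SLS

section Updates

variable {V T : Type*}

/-- The history after `t` has advanced the tail. -/
def History.advanceTail (H : History V T) (t : T) : History V T :=
  { H with
    tail := H.tail + 1
    writes := Function.update H.writes H.tail (H.writes H.tail ++ [(t, .TA)]) }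

/-- The history after `t` has advanced the head. -/
def History.advanceHead (H : History V T) (t : T) : History V T :=
  { H with
    head := H.head + 1
    writes := Function.update H.writes H.head (H.writes H.head ++ [(t, .HR)]) }

/-- The history after `t` has allocated a node at the address `o`. -/
def History.alloc (H : History V T) (t : T) (o : ℕ) : History V T :=
  { H with owner := Function.update H.owner o (some t) }

variable [DecidableEq T]

/-- The history after `t`, executing `i`, has appended its node at the address `o`. -/
def History.append (H : History V T) (t : T) (i : QInv V) (o : ℕ) : History V T :=
  { H with
    address := Function.update H.address (H.len + 1) o
    len := H.len + 1
    role := Function.update H.role t (.app H.len)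
    op := Function.update H.op H.len i
    writes := Function.update H.writes H.len [(t, appendLayer (tyOf i))]
    ops := Function.update H.ops H.len (pendingOps t i) }

/-- The history after `u`, executing `j`, has exchanged the item of the next node, which had been
appended by `t`, at the position `n` of the trace. -/
def History.exchange (H : History V T) (t u : T) (j : QInv V) (n : ℕ) : History V T :=
  { H with
    swaps := H.swaps + 1
    role := Function.update H.role u (.swp H.swaps)
    writes := Function.update H.writes H.swaps
      (H.writes H.swaps ++ [(u, swapLayer (tyOf (H.op H.swaps)))])
    ops := Function.update H.ops H.swaps (rendezvous t u (H.op H.swaps) j)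
    pos := Function.update H.pos H.swaps n }

end Updates

section Mem

variable {V T : Type*} {H : History V T} {g : Shared V} {i j : QInv V} {t u : T} {k o n : ℕ}
  {v : Node V}

theorem MemInv.alloc (hm : MemInv H g) :
    MemInv (H.alloc t g.size) { g.setNode g.size v with size := g.size + 1 } := by
  have node {k} (hk : k ≤ H.len) : Function.update g.node g.size v (H.address k) =
      g.node (H.address k) := Function.update_of_ne (hm.lt_size k hk).ne _ _
  exact
    { bounds := hm.bounds
      head_eq := hm.head_eq
      tail_eq := hm.tail_eq
      lt_size := fun k hk => (hm.lt_size k hk).trans_le (Nat.le_succ _)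
      inj := hm.inj
      next := fun k hk => (congrArg Node.next (node hk.le)).trans (hm.next k hk)
      last := (congrArg Node.next (node le_rfl)).trans hm.last
      type := fun k hk => (congrArg Node.type (node hk)).trans (hm.type k hk)
      same := hm.same
      item := fun k hsw hk => (congrArg Node.item (node hk)).trans (hm.item k hsw hk)
      app := fun t k ht => ⟨(hm.app t k ht).1, by
        have hk := hm.app t k ht
        simp only [History.alloc]
        rw [Function.update_of_ne (hm.lt_size _ hk.1).ne, hk.2]⟩
      swp := hm.swp }

theorem MemInv.advanceTail (hm : MemInv H g) (htail : H.tail < H.len) :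
    MemInv (H.advanceTail t) { g with tail := H.address (H.tail + 1) } := by
  have := hm.bounds
  exact { hm with
    bounds := by simp only [History.advanceTail]; omega
    tail_eq := rfl }

theorem MemInv.advanceHead (hm : MemInv H g) (hhead : H.head < H.swaps) :
    MemInv (H.advanceHead t) { g with head := H.address (H.head + 1) } := by
  have := hm.bounds
  exact { hm with
    bounds := by simp only [History.advanceHead]; omega
    head_eq := rfl
    same := fun j k hj hj' hk hk' =>
      hm.same j k (Nat.le_of_succ_le hj) hj' (Nat.le_of_succ_le hk) hk' }

variable [DecidableEq T]

theorem History.type_append (hk : k ≤ H.len) : (H.append t i o).type k = H.type k := by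
  cases k with
  | zero => rfl
  | succ k => simp [History.type, History.append, Nat.ne_of_lt hk]

theorem MemInv.append (hm : MemInv H g) (hf : Fresh H g i t o) (htail : H.tail = H.len)
    (hty : H.type H.len = tyOf i ∨ H.len ≤ H.head) :
    MemInv (H.append t i o)
      (g.setNode (H.address H.len) { g.node (H.address H.len) with next := some o }) := by
  obtain ⟨hbounds, hhead, htail', hsize, hinj, hnext, -, htype, hsame, hitem, happ, hswp⟩ := hm
  obtain ⟨-, howner, hosize, hne, hnode⟩ := hf
  have address : ∀ k ≤ H.len, (H.append t i o).address k = H.address k := fun k hk =>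
    Function.update_of_ne (by omega) _ _
  have address_last : (H.append t i o).address (H.len + 1) = o := Function.update_self _ _ _
  have op : ∀ k < H.len, (H.append t i o).op k = H.op k := fun k hk =>
    Function.update_of_ne hk.ne _ _
  have op_last : (H.append t i o).op H.len = i := Function.update_self _ _ _
  have role : ∀ u ≠ t, (H.append t i o).role u = H.role u := fun u hu =>
    Function.update_of_ne hu _ _
  have role_self : (H.append t i o).role t = .app H.len := Function.update_self _ _ _
  have hlen : (H.append t i o).len = H.len + 1 := rfl
  have type : ∀ k ≤ H.len, (H.append t i o).type k = H.type k := fun k => H.type_append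
  have type_last : (H.append t i o).type (H.len + 1) = tyOf i := congrArg tyOf op_last
  have htail_eq : (H.append t i o).tail = H.tail := rfl
  have hhead_eq : (H.append t i o).head = H.head := rfl
  have hswaps_eq : (H.append t i o).swaps = H.swaps := rfl
  have howner_eq : (H.append t i o).owner = H.owner := rfl
  generalize H.append t i o = H' at *
  have hsame_last : ∀ k, H.head ≤ k → k < H.len → tyOf (H.op k) = tyOf i := fun k hk hk' => by
    obtain ⟨m, hm⟩ : ∃ m, H.len = m + 1 := ⟨H.len - 1, by omega⟩
    rw [hsame k m hk hk' (by omega) (by omega), ← hty.resolve_right (by omega), hm, History.type]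
  constructor <;> try simp only [Shared.setNode]
  all_goals grind

theorem History.type_exchange : (H.exchange t u j n).type k = H.type k := by
  cases k <;> rfl

theorem MemInv.exchange (hm : MemInv H g) (hhead : H.head = H.swaps) (htail : H.swaps < H.tail)
    {a : Option V} : MemInv (H.exchange t u j n) (g.setNode (H.address (H.swaps + 1))
      { g.node (H.address (H.swaps + 1)) with item := a }) := by
  obtain ⟨hbounds, hhead, htail', hsize, hinj, hnext, hlast, htype, hsame, hitem, happ, hswp⟩ := hm
  have type : ∀ k, (H.exchange t u j n).type k = H.type k := fun _ => H.type_exchange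
  constructor <;> (try simp only [type, Shared.setNode]) <;> simp only [History.exchange]
  all_goals grind

end Mem

end SLS

/-! ### Preservation of the history invariant -/

namespace SLS

/-- What holds of the history of a configuration with the shared memory `g`. -/
structure HistoryInv {V T : Type*} (env : T → Option (QInv V)) (H : History V T) (g : Shared V) :
    Prop where
  mem : MemInv H g
  block : ∀ k < H.len, Block env H g k
  blockWrites : ∀ k < H.len, BlockWrites env H k

section StepOf

variable {V T : Type*} {H : History V T} {g : Shared V} {i j : QInv V} {t u : T} {k o n : ℕ}
  {v : Node V}

theorem Continues.refl (H : History V T) : Continues H H :=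
  ⟨le_rfl, le_rfl, le_rfl, le_rfl, fun _ _ => rfl, fun _ _ => rfl, fun _ _ => rfl⟩

theorem continues_advanceTail : Continues H (H.advanceTail t) :=
  { Continues.refl H with tail := Nat.le_succ _ }

theorem continues_advanceHead : Continues H (H.advanceHead t) :=
  { Continues.refl H with head := Nat.le_succ _ }

theorem continues_append [DecidableEq T] (h : H.swaps ≤ H.len) : Continues H (H.append t i o) :=
  { Continues.refl H with
    len := Nat.le_succ _
    address := fun _ hk => Function.update_of_ne (Nat.lt_succ_of_le hk).ne _ _
    op := fun _ hk => Function.update_of_ne hk.ne _ _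
    ops := fun _ hk => Function.update_of_ne (hk.trans_le h).ne _ _ }

theorem continues_exchange [DecidableEq T] : Continues H (H.exchange t u j n) :=
  { Continues.refl H with
    swaps := Nat.le_succ _
    ops := fun _ hk => Function.update_of_ne hk.ne _ _ }

theorem StepOf.refl : StepOf t H H g g :=
  ⟨.refl H, fun _ _ => rfl, fun _ _ _ _ h => h⟩

theorem stepOf_alloc :
    StepOf t H (H.alloc t g.size) g { g.setNode g.size v with size := g.size + 1 } where
  continues := { Continues.refl H with }
  role _ _ := rfl
  fresh _ _ _ _ hf :=
    { hf with
      owner := (Function.update_of_ne hf.lt_size.ne _ _).trans hf.owner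
      lt_size := hf.lt_size.trans (Nat.lt_succ_self _)
      node := (Function.update_of_ne hf.lt_size.ne _ _).trans hf.node }

theorem stepOf_advanceTail (a : ℕ) : StepOf t H (H.advanceTail t) g { g with tail := a } where
  continues := continues_advanceTail
  role _ _ := rfl
  fresh _ _ _ _ hf := { hf with }

theorem stepOf_advanceHead (a : ℕ) : StepOf t H (H.advanceHead t) g { g with head := a } where
  continues := continues_advanceHead
  role _ _ := rfl
  fresh _ _ _ _ hf := { hf with }

variable [DecidableEq T]

theorem stepOf_append (hm : MemInv H g) (hf : Fresh H g i t o) :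
    StepOf t H (H.append t i o) g (g.setNode (H.address H.len) v) where
  continues := continues_append (by have := hm.bounds; omega)
  role u hu := Function.update_of_ne hu _ _
  fresh u hu i' o' hf' :=
    { hf' with
      role := (Function.update_of_ne hu _ _).trans hf'.role
      ne_address := fun k hk => by
        rcases Nat.le_succ_iff.1 hk with hk | rfl
        · exact (congrArg (· ≠ o') (Function.update_of_ne (Nat.lt_succ_of_le hk).ne _ _)).mpr
            (hf'.ne_address k hk)
        · exact (congrArg (· ≠ o') (Function.update_self _ _ _)).mpr fun h =>
            hu (Option.some.inj (hf'.owner.symm.trans (h ▸ hf.owner)))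
      node := (Function.update_of_ne (hf'.ne_address _ le_rfl).symm _ _).trans hf'.node }

theorem stepOf_exchange (hlen : H.swaps < H.len) :
    StepOf u H (H.exchange t u j n) g (g.setNode (H.address (H.swaps + 1)) v) where
  continues := continues_exchange
  role _ hu := Function.update_of_ne hu _ _
  fresh _ hu _ _ hf :=
    { hf with
      role := (Function.update_of_ne hu _ _).trans hf.role
      node := (Function.update_of_ne (hf.ne_address _ hlen).symm _ _).trans hf.node }

end StepOf

section Mono

variable {V T : Type*} {env : T → Option (QInv V)} {H H' : History V T} {g g' : Shared V} {t : T}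
  {k : ℕ}

theorem Block.congr (hb : Block env H g k) (hsw : k < H'.swaps ↔ k < H.swaps)
    (hrole : ∀ t, (H.role t).IsIn k → H'.role t = H.role t)
    (hop : H'.op k = H.op k) (hops : H'.ops k = H.ops k)
    (hitem : (g'.node (H'.address (k + 1))).item = (g.node (H.address (k + 1))).item) :
    Block env H' g' k := by
  cases hb with
  | pending t h ht henv ho =>
    exact .pending t (not_lt.1 fun h' => (hsw.1 h').not_ge h) ((hrole t (.inl ht)).trans ht)
      (by rw [hop, henv]) (by rw [hops, hop, ho])
  | exchanged t u j h ht henv hu huenv hty hi ho =>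
    exact .exchanged t u j (hsw.2 h) ((hrole t (.inl ht)).trans ht) (by rw [hop, henv])
      ((hrole u (.inr hu)).trans hu) huenv (by rwa [hop]) (hitem.trans hi) (by rw [hops, hop, ho])

theorem MayWrite.mono (h : MayWrite env H t k) (hty : H'.type k = H.type k)
    (hhead : H.head ≤ H'.head)
    (hrole : H'.role t = H.role t ∨ H.role t = .free ∧ ∀ j, H'.role t = .app j → k ≤ j) :
    MayWrite env H' t k := by
  obtain ⟨hr, h⟩ := h
  rcases hrole with hrole | ⟨hfree, hrole⟩
  · refine ⟨fun j hj => hr j (hrole ▸ hj), ?_⟩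
    rw [hrole, hty]
    exact h.imp_right (.imp_right hhead.trans')
  · refine ⟨hrole, .inr ?_⟩
    rw [hty]
    exact (h.resolve_left (by simp [hfree])).imp_right hhead.trans'

theorem BlockWrites.congr (hb : BlockWrites env H k)
    (hmay : ∀ t, MayWrite env H t k → MayWrite env H' t k) (hwrites : H'.writes k = H.writes k)
    (hty : H'.type (k + 1) = H.type (k + 1)) (htl : k < H'.tail ↔ k < H.tail)
    (hsw : k < H'.swaps ↔ k < H.swaps) (hhd : k < H'.head ↔ k < H.head) :
    BlockWrites env H' k where
  letters := by rw [hwrites, hb.letters, hty, blockLayers_congr htl hsw hhd]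
  writer x hx hside := hmay _ (hb.writer x (hwrites ▸ hx) hside)

theorem BlockWrites.extend (hb : BlockWrites env H k) (y : T × Layer)
    (hmay : ∀ t, MayWrite env H t k → MayWrite env H' t k)
    (hwrites : H'.writes k = H.writes k ++ [y])
    (hletters : blockLayers (H'.type (k + 1)) H'.tail H'.swaps H'.head k =
      blockLayers (H.type (k + 1)) H.tail H.swaps H.head k ++ [y.2])
    (hy : y.2.TailSide → MayWrite env H y.1 k) : BlockWrites env H' k where
  letters := by rw [hwrites, List.map_append, hb.letters, hletters, List.map_singleton]
  writer x hx hside := by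
    rw [hwrites, List.mem_append, List.mem_singleton] at hx
    rcases hx with hx | rfl
    exacts [hmay _ (hb.writer x hx hside), hmay _ (hy hside)]

end Mono

section HistoryInv

variable {V T : Type*} {env : T → Option (QInv V)} {H : History V T} {g : Shared V} {i j : QInv V}
  {t u : T} {k o n : ℕ} {v : Node V}

theorem HistoryInv.alloc (h : HistoryInv env H g) :
    HistoryInv env (H.alloc t g.size) { g.setNode g.size v with size := g.size + 1 } where
  mem := h.mem.alloc
  block k hk := (h.block k hk).congr .rfl (fun _ _ => rfl) rfl rfl
    (congrArg Node.item (Function.update_of_ne (h.mem.lt_size _ hk).ne _ _))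
  blockWrites k hk := ⟨(h.blockWrites k hk).letters, (h.blockWrites k hk).writer⟩

theorem HistoryInv.advanceTail (h : HistoryInv env H g) (htail : H.tail < H.len)
    (ht : MayWrite env H t H.tail) :
    HistoryInv env (H.advanceTail t) { g with tail := H.address (H.tail + 1) } where
  mem := h.mem.advanceTail htail
  block k hk := (h.block k hk).congr .rfl (fun _ _ => rfl) rfl rfl rfl
  blockWrites k hk := by
    have hbounds := h.mem.bounds
    have may (u) (hu : MayWrite env H u k) : MayWrite env (H.advanceTail t) u k :=
      hu.mono (by cases k <;> rfl) le_rfl (.inl rfl)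
    by_cases hk' : k = H.tail
    · subst hk'
      exact (h.blockWrites _ hk).extend (t, .TA) may (Function.update_self _ _ _)
        (blockLayers_succ_tail hbounds.2.2.1 (hbounds.1.trans hbounds.2.2.1)) fun _ => ht
    · exact (h.blockWrites k hk).congr may (Function.update_of_ne hk' _ _) rfl
        (by simp only [History.advanceTail]; omega) .rfl .rfl

theorem HistoryInv.advanceHead (h : HistoryInv env H g) (hhead : H.head < H.swaps) :
    HistoryInv env (H.advanceHead t) { g with head := H.address (H.head + 1) } where
  mem := h.mem.advanceHead hhead
  block k hk := (h.block k hk).congr .rfl (fun _ _ => rfl) rfl rfl rfl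
  blockWrites k hk := by
    have may (u) (hu : MayWrite env H u k) : MayWrite env (H.advanceHead t) u k :=
      hu.mono (by cases k <;> rfl) (Nat.le_succ _) (.inl rfl)
    by_cases hk' : k = H.head
    · subst hk'
      exact (h.blockWrites _ hk).extend (t, .HR) may (Function.update_self _ _ _)
        blockLayers_succ_head False.elim
    · exact (h.blockWrites k hk).congr may (Function.update_of_ne hk' _ _) rfl .rfl .rfl
        (by simp only [History.advanceHead]; omega)

variable [DecidableEq T]

theorem HistoryInv.block_append (h : HistoryInv env H g) (hf : Fresh H g i t o)
    (hi : env t = some i) (hk : k < (H.append t i o).len) :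
    Block env (H.append t i o)
      (g.setNode (H.address H.len) { g.node (H.address H.len) with next := some o }) k := by
  have hbounds := h.mem.bounds
  rcases Nat.lt_succ_iff_lt_or_eq.1 hk with hk | rfl
  · refine (h.block k hk).congr .rfl (fun u hu => Function.update_of_ne ?_ _ _)
      (Function.update_of_ne hk.ne _ _) (Function.update_of_ne hk.ne _ _) ?_
    · rintro rfl
      simp [hf.role, Role.IsIn] at hu
    · simp only [History.append, Shared.setNode, Function.update_apply]
      grind
  · refine .pending t (by simp only [History.append]; omega) (Function.update_self _ _ _) ?_ ?_
    · simpa [History.append] using hi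
    · simp [History.append]

theorem HistoryInv.blockWrites_append (h : HistoryInv env H g) (hf : Fresh H g i t o)
    (htail : H.tail = H.len) (hk : k < (H.append t i o).len) :
    BlockWrites env (H.append t i o) k := by
  have hbounds := h.mem.bounds
  rcases Nat.lt_succ_iff_lt_or_eq.1 hk with hlt | rfl
  · refine (h.blockWrites k hlt).congr
      (fun u hu => hu.mono (History.type_append hlt.le) le_rfl ?_)
      (Function.update_of_ne hlt.ne _ _) (History.type_append hlt) .rfl .rfl .rfl
    by_cases hut : u = t
    · subst hut
      refine .inr ⟨hf.role, fun j hj => ?_⟩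
      obtain rfl := Role.app.inj ((Function.update_self _ _ _).symm.trans hj)
      exact hlt.le
    · exact .inl (Function.update_of_ne hut _ _)
  · have hrole : (H.append t i o).role t = .app H.len := Function.update_self _ _ _
    have hwrites : (H.append t i o).writes H.len = [(t, appendLayer (tyOf i))] :=
      Function.update_self _ _ _
    have htype : (H.append t i o).type (H.len + 1) = tyOf i :=
      congrArg tyOf (Function.update_self _ _ _)
    refine ⟨?_, ?_⟩
    · rw [hwrites, htype]
      exact (blockLayers_eq_singleton htail.le (by simp only [History.append]; omega)
        (by simp only [History.append]; omega)).symm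
    · simp [hwrites, MayWrite, hrole]

theorem HistoryInv.append (h : HistoryInv env H g) (hf : Fresh H g i t o) (hi : env t = some i)
    (htail : H.tail = H.len) (hty : H.type H.len = tyOf i ∨ H.len ≤ H.head) :
    HistoryInv env (H.append t i o)
      (g.setNode (H.address H.len) { g.node (H.address H.len) with next := some o }) where
  mem := h.mem.append hf htail hty
  block _ hk := h.block_append hf hi hk
  blockWrites _ hk := h.blockWrites_append hf htail hk

theorem HistoryInv.block_exchange (h : HistoryInv env H g) (hrole : H.role u = .free)
    (hj : env u = some j) (htail : H.swaps < H.tail) (hty : tyOf (H.op H.swaps) ≠ tyOf j)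
    (ht : H.role t = .app H.swaps) (hk : k < H.len) :
    Block env (H.exchange t u j n) (g.setNode (H.address (H.swaps + 1))
      { g.node (H.address (H.swaps + 1)) with item := argOf j }) k := by
  have hbounds := h.mem.bounds
  have role (u') (hu' : u' ≠ u) : (H.exchange t u j n).role u' = H.role u' :=
    Function.update_of_ne hu' _ _
  by_cases hks : k = H.swaps
  · subst hks
    have ht' : (H.exchange t u j n).role t = .app H.swaps :=
      (role t (by rintro rfl; simp [hrole] at ht)).trans ht
    have henv : env t = some (H.op H.swaps) := by
      cases h.block _ hk with
      | pending t' _ ht' henv => exact h.mem.app_inj ht ht' ▸ henv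
      | exchanged _ _ _ hlt => exact absurd hlt (lt_irrefl _)
    exact .exchanged t u j (Nat.lt_succ_self _) ht' henv (Function.update_self _ _ _) hj hty
      (by simp [History.exchange, Shared.setNode]) (Function.update_self _ _ _)
  · refine (h.block k hk).congr (by simp only [History.exchange]; omega)
      (fun u' hu' => role u' ?_) rfl (Function.update_of_ne hks _ _) ?_
    · rintro rfl
      simp [hrole, Role.IsIn] at hu'
    · have := h.mem.inj (k + 1) hk (H.swaps + 1) (by omega)
      simp only [History.exchange, Shared.setNode, Function.update_apply]
      grind

theorem HistoryInv.blockWrites_exchange (h : HistoryInv env H g) (hrole : H.role u = .free)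
    (hhead : H.head = H.swaps) (hk : k < H.len) :
    BlockWrites env (H.exchange t u j n) k := by
  have may (u') (hu' : MayWrite env H u' k) : MayWrite env (H.exchange t u j n) u' k := by
    refine hu'.mono History.type_exchange le_rfl ?_
    by_cases hu : u' = u
    · subst hu
      exact .inr ⟨hrole, fun j' hj' => by simp [History.exchange] at hj'⟩
    · exact .inl (Function.update_of_ne hu _ _)
  by_cases hks : k = H.swaps
  · subst hks
    exact (h.blockWrites _ hk).extend (u, swapLayer (tyOf (H.op H.swaps))) may
      (Function.update_self _ _ _) (blockLayers_succ_swaps hhead.le) fun hside => by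
        cases hop : H.op H.swaps <;> simp [hop, swapLayer, tyOf, Layer.TailSide] at hside
  · exact (h.blockWrites k hk).congr may (Function.update_of_ne hks _ _) rfl .rfl
      (by simp only [History.exchange]; omega) .rfl

theorem HistoryInv.exchange (h : HistoryInv env H g) (hrole : H.role u = .free)
    (hj : env u = some j) (hhead : H.head = H.swaps) (htail : H.swaps < H.tail)
    (hty : tyOf (H.op H.swaps) ≠ tyOf j) (ht : H.role t = .app H.swaps) :
    HistoryInv env (H.exchange t u j n) (g.setNode (H.address (H.swaps + 1))
      { g.node (H.address (H.swaps + 1)) with item := argOf j }) where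
  mem := h.mem.exchange hhead htail
  block _ hk := h.block_exchange hrole hj htail hty ht hk
  blockWrites _ hk := h.blockWrites_exchange hrole hhead hk

end HistoryInv

end SLS

/-! ### The history of a trace -/

namespace SLS

open Relation (ReflTransGen)

/-- The positions recorded in the history can serve as linearization points in the trace. A pending
operation can be linearized at the end of the trace, since by `inv_lt` the invocation of a thread
that takes part in a block is not the last step. -/
structure TraceInv {V T : Type*} (H : History V T)
    (τ : List (T × Label (QInv V) (Option V) Act Tst)) : Prop where
  returned : ∀ t r, (t, .ret r) ∈ τ → ∃ i, ∃ k < H.swaps, (t, i, r) ∈ H.ops k ∧ (H.role t).IsIn k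
  inv_lt : ∀ t i j, H.role t ≠ .free → τ[j]? = some (t, .inv i) → j + 1 < τ.length
  pos_lt : ∀ k < H.swaps, H.pos k < τ.length
  mono : ∀ j k, j ≤ k → k < H.swaps → H.pos j ≤ H.pos k
  pos_inv : ∀ t i j, ∀ k < H.swaps, (H.role t).IsIn k → τ[j]? = some (t, .inv i) → j < H.pos k
  pos_ret : ∀ t r j, ∀ k < H.swaps, (H.role t).IsIn k → τ[j]? = some (t, .ret r) → H.pos k < j

/-- The history `H` explains the trace `τ` that has led to the shared memory `g`. -/
structure Explains {V T : Type*} (env : T → Option (QInv V)) (H : History V T) (g : Shared V)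
    (τ : List (T × Label (QInv V) (Option V) Act Tst)) : Prop
    extends HistoryInv env H g, TraceInv H τ where
  order : ReflTransGen Exchange (writes env τ) ((List.range H.len).flatMap H.writes)

theorem getElem?_concat_eq_some_iff {α : Type*} {l : List α} {x y : α} {j : ℕ} :
    (l ++ [x])[j]? = some y ↔ l[j]? = some y ∨ j = l.length ∧ x = y := by
  rcases lt_trichotomy j l.length with hj | rfl | hj
  · simp [List.getElem?_append_left hj, hj.ne]
  · simp
  · simp [List.getElem?_eq_none hj.le, hj.ne', hj]

section Trace

variable {V T : Type*} {H H' : History V T} {t u : T} {i : QInv V} {r : Option V} {k : ℕ}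
  {τ : List (T × Label (QInv V) (Option V) Act Tst)} {ℓ : Label (QInv V) (Option V) Act Tst}

theorem Role.IsIn.eq {ρ : Role} {j : ℕ} (hj : ρ.IsIn j) (hk : ρ.IsIn k) : j = k := by
  rcases hj with rfl | rfl <;> rcases hk with h | h <;> cases h <;> rfl

theorem Role.IsIn.ne_free {ρ : Role} (h : ρ.IsIn k) : ρ ≠ .free := by
  rintro rfl
  rcases h with h | h <;> cases h

theorem TraceInv.returned_concat (h : TraceInv H τ)
    (hret : ∀ r, ℓ = .ret r → ∃ i, ∃ k < H.swaps, (t, i, r) ∈ H.ops k ∧ (H.role t).IsIn k)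
    (hx : (u, .ret r) ∈ τ ++ [(t, ℓ)]) :
    ∃ i, ∃ k < H.swaps, (u, i, r) ∈ H.ops k ∧ (H.role u).IsIn k := by
  rcases List.mem_append.1 hx with hx | hx
  · exact h.returned u r hx
  · obtain ⟨rfl, heq⟩ := Prod.mk.inj (List.mem_singleton.1 hx)
    exact hret r heq.symm

theorem TraceInv.step (h : TraceInv H τ) (hc : Continues H H')
    (hpos : ∀ k < H'.swaps, k < H.swaps ∧ H'.pos k = H.pos k ∨ H.swaps ≤ k ∧ H'.pos k = τ.length)
    (hrole : ∀ u, H'.role u = H.role u ∨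
      H.role u = .free ∧ ∀ k, (H'.role u).IsIn k → H.swaps ≤ k)
    (hinv : ∀ i, ℓ = .inv i → H'.role t = .free)
    (hret : ∀ r, ℓ = .ret r → ∃ i, ∃ k < H.swaps, (t, i, r) ∈ H.ops k ∧ (H.role t).IsIn k) :
    TraceInv H' (τ ++ [(t, ℓ)]) := by
  have hlt {j : ℕ} {x} (hx : τ[j]? = some x) : j < τ.length := (List.getElem?_eq_some_iff.1 hx).1
  have old_inv {j : ℕ} {u : T} {i : QInv V} (hu : H'.role u ≠ .free)
      (hx : (τ ++ [(t, ℓ)])[j]? = some (u, Label.inv i)) : τ[j]? = some (u, Label.inv i) :=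
    (getElem?_concat_eq_some_iff.1 hx).resolve_right fun ⟨_, hx⟩ => by
      obtain ⟨rfl, heq⟩ := Prod.mk.inj hx
      exact hu (hinv i heq)
  have isIn_old {u k} (hk : k < H.swaps) (hu : (H'.role u).IsIn k) : (H.role u).IsIn k := by
    rcases hrole u with heq | ⟨-, hnew⟩
    exacts [heq ▸ hu, absurd hk (hnew k hu).not_gt]
  have isIn_new {u k} (hu : (H.role u).IsIn k) : (H'.role u).IsIn k := by
    rcases hrole u with heq | ⟨hfree, -⟩
    exacts [heq.symm ▸ hu, by simp [hfree, Role.IsIn] at hu]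
  exact
    { returned := fun u r hx => by
        obtain ⟨i, k, hk, hops, hin⟩ := h.returned_concat hret hx
        exact ⟨i, k, hk.trans_le hc.swaps, by rwa [hc.ops k hk], isIn_new hin⟩
      inv_lt := fun u i j hu hx => by
        rw [List.length_append]
        exact Nat.succ_lt_succ (hlt (old_inv hu hx))
      pos_lt := fun k hk => by
        have := h.pos_lt k
        grind
      mono := fun j k hjk hk => by
        have := h.mono j k hjk
        have := h.pos_lt j
        grind
      pos_inv := fun u i j k hk hu hx => by
        rcases hpos k hk with ⟨hk, heq⟩ | ⟨-, heq⟩ <;> rw [heq]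
        exacts [h.pos_inv u i j k hk (isIn_old hk hu) (old_inv hu.ne_free hx),
          hlt (old_inv hu.ne_free hx)]
      pos_ret := fun u r j k hk hu hx => by
        obtain ⟨i, k', hk', -, hin⟩ := h.returned_concat hret (List.mem_of_getElem? hx)
        obtain rfl := (isIn_new hin).eq hu
        rw [((hpos k' hk).resolve_right fun h => h.1.not_gt hk').2]
        rcases getElem?_concat_eq_some_iff.1 hx with hx | ⟨rfl, -⟩
        exacts [h.pos_ret u r j k' hk' hin hx, h.pos_lt k' hk'] }

theorem TraceInv.write (h : TraceInv H τ) {y : Layer} (hy : layerOf i ℓ = some y)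
    (hc : Continues H H')
    (hpos : ∀ k < H'.swaps, k < H.swaps ∧ H'.pos k = H.pos k ∨ H.swaps ≤ k ∧ H'.pos k = τ.length)
    (hrole : ∀ u, H'.role u = H.role u ∨
      H.role u = .free ∧ ∀ k, (H'.role u).IsIn k → H.swaps ≤ k) :
    TraceInv H' (τ ++ [(t, ℓ)]) :=
  h.step hc hpos hrole (by rintro _ rfl; cases i <;> cases hy)
    (by rintro _ rfl; cases i <;> cases hy)

end Trace

section Explains

variable {V T : Type*} {env : T → Option (QInv V)} {H : History V T} {g : Shared V} {i j : QInv V}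
  {t u : T} {k o : ℕ} {v : Node V} {τ : List (T × Label (QInv V) (Option V) Act Tst)}
  {ℓ : Label (QInv V) (Option V) Act Tst}

theorem HistoryInv.of_mem_later_writes (h : HistoryInv env H g)
    (ht : H.role t = .app k ∨
      (∀ j, H.role t ≠ .app j) ∧ ∃ i, env t = some i ∧ tyOf (H.op k) ≠ tyOf i)
    (hhead : H.head ≤ k) (hswaps : H.swaps ≤ k + 1) {m : ℕ} (hkm : k < m) (hm : m < H.len) :
    ∀ x ∈ H.writes m, x.1 ≠ t ∧ x.2.TailSide := by
  intro x hx
  have hside : x.2.TailSide := by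
    have hletter := List.mem_map_of_mem (f := Prod.snd) hx
    rw [(h.blockWrites m hm).letters, mem_blockLayers] at hletter
    rcases hletter with heq | ⟨-, heq⟩ | ⟨hlt, -⟩ | ⟨hlt, -⟩
    · exact heq ▸ appendLayer_tailSide _
    · rw [heq]; trivial
    all_goals omega
  refine ⟨?_, hside⟩
  rintro rfl
  obtain ⟨hfirst, hmay⟩ := (h.blockWrites m hm).writer x hx hside
  rcases ht with ht | ⟨hrole, i, hi, hne⟩
  · exact absurd (hfirst k ht) (by omega)
  · rcases hmay with hmay | ⟨i', hi', hty⟩ | hmay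
    · exact hrole m hmay
    · obtain rfl := Option.some.inj (hi.symm.trans hi')
      obtain ⟨m, rfl⟩ : ∃ m', m = m' + 1 := ⟨m - 1, by omega⟩
      exact hne ((h.mem.same k m hhead (by omega) (by omega) (by omega)).trans hty)
    · omega

theorem Explains.concat (h : Explains env H g τ) (hi : env t = some i) (hy : layerOf i ℓ = none)
    (hinv : ∀ i, ℓ = .inv i → H.role t = .free)
    (hret : ∀ r, ℓ = .ret r → ∃ i, ∃ k < H.swaps, (t, i, r) ∈ H.ops k ∧ (H.role t).IsIn k) :
    Explains env H g (τ ++ [(t, ℓ)]) where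
  toHistoryInv := h.toHistoryInv
  toTraceInv := h.toTraceInv.step (.refl H) (fun _ hk => .inl ⟨hk, rfl⟩) (fun _ => .inl rfl)
    hinv hret
  order := (writes_append_of_none hi hy).symm ▸ h.order

theorem Explains.alloc (h : Explains env H g τ) (hi : env t = some i) {a : Act} :
    Explains env (H.alloc t g.size) { g.setNode g.size v with size := g.size + 1 }
      (τ ++ [(t, .act a)]) where
  toHistoryInv := h.toHistoryInv.alloc
  toTraceInv := h.toTraceInv.step { Continues.refl H with } (fun _ hk => .inl ⟨hk, rfl⟩)
    (fun _ => .inl rfl) nofun nofun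
  order := by
    rw [writes_append_of_none hi (by cases i <;> rfl)]
    exact h.order

theorem Explains.advanceTail (h : Explains env H g τ) (hi : env t = some i)
    (hy : layerOf i ℓ = some .TA) (htail : H.tail < H.len) (ht : MayWrite env H t H.tail) :
    Explains env (H.advanceTail t) { g with tail := H.address (H.tail + 1) } (τ ++ [(t, ℓ)]) where
  toHistoryInv := h.toHistoryInv.advanceTail htail ht
  toTraceInv := h.toTraceInv.write hy continues_advanceTail
    (fun _ hk => .inl ⟨hk, rfl⟩) fun _ => .inl rfl
  order := by
    have hbounds := h.mem.bounds
    rw [writes_append_of_some hi hy]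
    exact (exchanges_append_right h.order _).trans
      (exchanges_insert htail fun j hj hj' => by omega)

theorem Explains.advanceHead (h : Explains env H g τ) (hi : env t = some i)
    (hy : layerOf i ℓ = some .HR) (hhead : H.head < H.swaps)
    (ht : H.role t = .app H.head ∨
      (∀ j, H.role t ≠ .app j) ∧ tyOf (H.op H.head) ≠ tyOf i) :
    Explains env (H.advanceHead t) { g with head := H.address (H.head + 1) } (τ ++ [(t, ℓ)]) where
  toHistoryInv := h.toHistoryInv.advanceHead hhead
  toTraceInv := h.toTraceInv.write hy continues_advanceHead
    (fun _ hk => .inl ⟨hk, rfl⟩) fun _ => .inl rfl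
  order := by
    have hbounds := h.mem.bounds
    rw [writes_append_of_some hi hy]
    refine (exchanges_append_right h.order _).trans
      (exchanges_insert (by omega) fun m hkm hm x hx => ?_)
    obtain ⟨hne, hside⟩ := h.of_mem_later_writes (ht.imp_right fun ⟨hr, hty⟩ => ⟨hr, i, hi, hty⟩)
      le_rfl hbounds.2.1 hkm hm x hx
    exact ⟨hne, hside, trivial⟩

variable [DecidableEq T]

theorem Explains.append (h : Explains env H g τ) (hf : Fresh H g i t o) (hi : env t = some i)
    (hy : layerOf i ℓ = some (appendLayer (tyOf i))) (htail : H.tail = H.len)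
    (hty : H.type H.len = tyOf i ∨ H.len ≤ H.head) :
    Explains env (H.append t i o)
      (g.setNode (H.address H.len) { g.node (H.address H.len) with next := some o })
      (τ ++ [(t, ℓ)]) where
  toHistoryInv := h.toHistoryInv.append hf hi htail hty
  toTraceInv := by
    have hbounds := h.mem.bounds
    refine h.toTraceInv.write hy (continues_append (by omega)) (fun _ hk => .inl ⟨hk, rfl⟩)
      fun u => ?_
    by_cases hu : u = t
    · subst hu
      refine .inr ⟨hf.role, fun k hk => ?_⟩
      have hk : (Role.app H.len).IsIn k := by simpa [History.append] using hk
      exact (Role.IsIn.eq (.inl rfl) hk) ▸ by omega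
    · exact .inl (Function.update_of_ne hu _ _)
  order := by
    have hlen : (H.append t i o).len = H.len + 1 := rfl
    have hold : (List.range H.len).flatMap (H.append t i o).writes =
        (List.range H.len).flatMap H.writes :=
      List.flatMap_congr fun k hk => Function.update_of_ne (List.mem_range.1 hk).ne _ _
    have hnew : (H.append t i o).writes H.len = [(t, appendLayer (tyOf i))] :=
      Function.update_self _ _ _
    rw [writes_append_of_some hi hy, hlen, List.range_succ, List.flatMap_append,
      List.flatMap_singleton, hold, hnew]
    exact exchanges_append_right h.order _

theorem Explains.exchange (h : Explains env H g τ) (hrole : H.role u = .free)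
    (hj : env u = some j) (hy : layerOf j ℓ = some (swapLayer (tyOf (H.op H.swaps))))
    (hhead : H.head = H.swaps) (htail : H.swaps < H.tail)
    (hty : tyOf (H.op H.swaps) ≠ tyOf j) (ht : H.role t = .app H.swaps) :
    Explains env (H.exchange t u j τ.length) (g.setNode (H.address (H.swaps + 1))
      { g.node (H.address (H.swaps + 1)) with item := argOf j }) (τ ++ [(u, ℓ)]) where
  toHistoryInv := h.toHistoryInv.exchange hrole hj hhead htail hty ht
  toTraceInv := by
    refine h.toTraceInv.write hy continues_exchange (fun k hk => ?_) fun u' => ?_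
    · rcases Nat.lt_succ_iff_lt_or_eq.1 hk with hk | rfl
      exacts [.inl ⟨hk, Function.update_of_ne hk.ne _ _⟩,
        .inr ⟨le_rfl, Function.update_self _ _ _⟩]
    · by_cases hu : u' = u
      · subst hu
        refine .inr ⟨hrole, fun k hk => ?_⟩
        have hk : (Role.swp H.swaps).IsIn k := by simpa [History.exchange] using hk
        exact (Role.IsIn.eq (.inr rfl) hk).le
      · exact .inl (Function.update_of_ne hu _ _)
  order := by
    have hbounds := h.mem.bounds
    rw [writes_append_of_some hj hy]
    refine (exchanges_append_right h.order _).trans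
      (exchanges_insert (by omega) fun m hkm hm x hx => ?_)
    obtain ⟨hne, hside⟩ := h.of_mem_later_writes (.inr ⟨fun m => by simp [hrole], j, hj, hty⟩)
      hhead.le (Nat.le_succ _) hkm hm x hx
    exact ⟨hne, hside, swapLayer_headSide _⟩

end Explains

end SLS

/-! ### The steps of a thread -/

namespace SLS

variable {V T : Type*}

/-- A step of `t`, executing `i`, with label `ℓ` from a configuration with the history `H` and the
shared memory `g` to the program counter `pc` continues the history to `H'`. -/
structure StepExplained (env : T → Option (QInv V)) (H H' : History V T) (g g' : Shared V)
    (τ : List (T × Label (QInv V) (Option V) Act Tst)) (t : T) (i : QInv V)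
    (ℓ : Label (QInv V) (Option V) Act Tst) (l : Loc V) (pc : PC) : Prop where
  explains : Explains env H' g' (τ ++ [(t, ℓ)])
  stepOf : StepOf t H H' g g'
  at_pc : At H' g' i t l pc

section Writes

variable {env : T → Option (QInv V)} {H : History V T} {g : Shared V} {i : QInv V} {t : T}
  {l : Loc V} {pc pc' : PC} {k p q : ℕ} {a : Act} {b : Tst} {y : Layer}
  {τ : List (T × Label (QInv V) (Option V) Act Tst)} {ℓ : Label (QInv V) (Option V) Act Tst}

theorem Explains.step_newOffer (h : Explains env H g τ) (hi : env t = some i)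
    (hrole : H.role t = .free) (harg : l.arg = argOf i) :
    StepExplained env H (H.alloc t g.size) g (actSem (.newOffer (tyOf i)) l g).2 τ t i
      (.act (.newOffer (tyOf i))) (actSem (.newOffer (tyOf i)) l g).1 .loop := by
  refine ⟨h.alloc hi, stepOf_alloc, .seeking 0 0 ⟨hrole, ?_, ?_, ?_, ?_⟩ trivial⟩
  · exact Function.update_self _ _ _
  · exact Nat.lt_succ_self _
  · exact fun k hk => (h.mem.lt_size k hk).ne
  · exact (Function.update_self _ _ _).trans (by rw [harg])

theorem Explains.step_tailToN (h : Explains env H g τ) (hi : env t = some i)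
    (hf : Fresh H g i t l.offer) (hs : Seeking H i l p q .tailCas) (htest : g.tail = l.t) :
    StepExplained env H (H.advanceTail t) g (actSem .tailToN l g).2 τ t i (.arw b .tailToN) l
      .loop := by
  obtain ⟨-, hlt, hty, hp, hln⟩ := hs
  obtain rfl := (h.mem.tail_eq_iff hp.le).1 (htest.trans hlt)
  have hmay : MayWrite env H t H.tail :=
    ⟨by simp [hf.role], .inr (hty.imp_left fun hty => ⟨i, hi, hty⟩)⟩
  have hmem : (actSem .tailToN l g).2 = { g with tail := H.address (H.tail + 1) } := by
    simp only [actSem, hln, addr, Option.getD_some]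
  rw [hmem]
  exact ⟨h.advanceTail hi (by cases i <;> rfl) hp hmay, stepOf_advanceTail _,
    .seeking 0 0 { hf with } trivial⟩

theorem Explains.step_tailToOffer (h : Explains env H g τ) (hi : env t = some i)
    (hrole : H.role t = .app k) (ho : l.offer = H.address (k + 1)) (hlt : l.t = H.address k)
    (htest : g.tail = l.t) :
    StepExplained env H (H.advanceTail t) g (actSem .tailToOffer l g).2 τ t i (.arw b .tailToOffer)
      l .wait := by
  have hk := (h.mem.app t k hrole).1
  obtain rfl := (h.mem.tail_eq_iff hk.le).1 (htest.trans hlt)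
  have hmay : MayWrite env H t H.tail :=
    ⟨fun j hj => (Role.app.inj (hrole.symm.trans hj)).le, .inl hrole⟩
  have hmem : (actSem .tailToOffer l g).2 = { g with tail := H.address (H.tail + 1) } := by
    simp only [actSem, ho]
  rw [hmem]
  exact ⟨h.advanceTail hi (by cases i <;> rfl) hk hmay, stepOf_advanceTail _,
    .appended H.tail 0 hrole ho (Nat.lt_succ_self _)⟩

theorem Explains.step_headToOffer (h : Explains env H g τ) (hi : env t = some i)
    (hrole : H.role t = .app k) (ho : l.offer = H.address (k + 1)) (hlh : l.h = H.address k)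
    (hk : k < H.swaps) (htest : g.head = l.h) :
    StepExplained env H (H.advanceHead t) g (actSem .headToOffer l g).2 τ t i (.arw b .headToOffer)
      l .finish := by
  obtain rfl := (h.mem.head_eq_iff (h.mem.app t k hrole).1.le).1 (htest.trans hlh)
  have hmem : (actSem .headToOffer l g).2 = { g with head := H.address (H.head + 1) } := by
    simp only [actSem, ho]
  rw [hmem]
  exact ⟨h.advanceHead hi (by cases i <;> rfl) hk (.inl hrole),
    stepOf_advanceHead _, .appended H.head 0 hrole ho hk⟩

theorem Explains.step_headToN (h : Explains env H g τ) (hi : env t = some i)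
    (hrole : ∀ j, H.role t ≠ .app j) (hk : k < H.swaps) (hlh : l.h = H.address k)
    (hty : tyOf (H.op k) ≠ tyOf i) (hln : l.n = some (H.address (k + 1))) (htest : g.head = l.h)
    (hat : At (H.advanceHead t) { g with head := H.address (k + 1) } i t l pc) :
    StepExplained env H (H.advanceHead t) g (actSem .headToN l g).2 τ t i (.arw b .headToN) l
      pc := by
  have hbounds := h.mem.bounds
  obtain rfl := (h.mem.head_eq_iff (by omega)).1 (htest.trans hlh)
  have hmem : (actSem .headToN l g).2 = { g with head := H.address (H.head + 1) } := by
    simp only [actSem, hln, addr, Option.getD_some]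
  rw [hmem]
  exact ⟨h.advanceHead hi (by cases i <;> rfl) hk (.inr ⟨hrole, hty⟩),
    stepOf_advanceHead _, hat⟩

theorem Explains.step_headToN_of_swapped (h : Explains env H g τ) (hi : env t = some i)
    (hk : k < H.swaps) (hrole : H.role t = .swp k) (hlh : l.h = H.address k)
    (hln : l.n = some (H.address (k + 1))) (hty : tyOf (H.op k) ≠ tyOf i)
    (hops : (t, i, l.x) ∈ H.ops k) (htest : g.head = l.h) :
    StepExplained env H (H.advanceHead t) g (actSem .headToN l g).2 τ t i (.arw b .headToN) l
      .atRet := by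
  have hbounds := h.mem.bounds
  exact h.step_headToN hi (by simp [hrole]) hk hlh hty hln htest
    (.atRet ⟨k, hk, hops, .inr ⟨hrole, by simp only [History.advanceHead]; omega⟩⟩)

variable [DecidableEq T]

theorem Explains.step_linkOffer (h : Explains env H g τ) (hi : env t = some i)
    (hf : Fresh H g i t l.offer) (hs : Seeking H i l p q .linkCas)
    (htest : (g.node l.t).next = l.n) :
    StepExplained env H (H.append t i l.offer) g (actSem .linkOffer l g).2 τ t i
      (.arw b .linkOffer) l .linked := by
  have hbounds := h.mem.bounds
  obtain ⟨hp, hlt, hty, hln⟩ := hs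
  obtain rfl : p = H.len := by
    rw [hlt, hln] at htest
    exact ((h.mem.next_eq_none_or (by omega)).resolve_right fun h => by simp [h.1] at htest).2
  have hmem : (actSem .linkOffer l g).2 = g.setNode (H.address H.len)
      { g.node (H.address H.len) with next := some l.offer } := by
    simp only [actSem, hlt]
  rw [hmem]
  refine ⟨h.append hf hi (by cases i <;> rfl) (by omega) hty,
    stepOf_append h.mem hf, .appended H.len 0 ?_ ?_ ?_⟩
  · exact Function.update_self _ _ _
  · exact (Function.update_self (H.len + 1) l.offer H.address).symm
  · rw [Appended, hlt]
    exact (Function.update_of_ne (Nat.lt_succ_self _).ne l.offer H.address).symm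

theorem Explains.step_exchange (h : Explains env H g τ) (hi : env t = some i)
    (hrole : H.role t = .free) (hq : q ≤ H.head) (hqt : q < H.tail) (hlh : l.h = H.address q)
    (hty : tyOf (H.op q) ≠ tyOf i) (hln : l.n = some (H.address (q + 1)))
    (hx : l.x = received i (H.op q))
    (htest : (g.node (addr l.n)).item = argOf (H.op q))
    (hy : layerOf i ℓ = some (swapLayer (tyOf (H.op q)))) :
    ∃ u, StepExplained env H (H.exchange u t i τ.length) g
      (g.setNode (addr l.n) { g.node (addr l.n) with item := argOf i }) τ t i ℓ l .swapped := by
  have hbounds := h.mem.bounds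
  have haddr : addr l.n = H.address (q + 1) := by rw [hln, addr, Option.getD_some]
  rw [haddr] at htest ⊢
  have hb := h.block q (by omega)
  have hsw := (h.mem.item_eq_iff hb (by omega)).1 htest
  obtain rfl : q = H.swaps := by omega
  obtain ⟨u, hu⟩ : ∃ u, H.role u = .app H.swaps := by
    cases hb with
    | pending u _ hu | exchanged u _ _ _ hu => exact ⟨u, hu⟩
  have hops : (H.exchange u t i τ.length).ops H.swaps = rendezvous u t (H.op H.swaps) i :=
    Function.update_self _ _ _
  exact ⟨u, h.exchange hrole hi hy (by omega) hqt hty hu,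
    stepOf_exchange (by omega),
    .swapped H.swaps (Nat.lt_succ_self _) (Function.update_self _ _ _) hlh hln hty
      (by rw [hops, hx]; exact mem_rendezvous.2 (.inr rfl))⟩

end Writes

section Steps

variable {env : T → Option (QInv V)} {H : History V T} {g g' : Shared V} {i : QInv V} {t : T}
  {l l' : Loc V} {pc pc' : PC} {k p q : ℕ} {a : Act} {b : Tst}
  {ι : Kat.Instr Act Tst} {τ : List (T × Label (QInv V) (Option V) Act Tst)}
  {ℓ : Label (QInv V) (Option V) Act Tst}

theorem Explains.step_arw_of_seeking (h : Explains env H g τ) (hi : env t = some i)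
    (harg : l.arg = argOf i) (hx : i ≠ .deq → l.x = none) (hf : Fresh H g i t l.offer)
    (hs : Seeking H i l p q pc) (he : (.arw b a, pc') ∈ pc.edges i) (htest : testSem b l g) :
    ∃ H', StepExplained env H H' g (actSem a l g).2 τ t i (.arw b a) l pc' := by
  classical
  cases pc <;> try contradiction
  all_goals
    cases i <;>
      simp only [PC.edges, List.mem_cons, List.not_mem_nil, Prod.mk.injEq, Kat.Instr.arw.injEq,
        reduceCtorEq, false_and, or_false, false_or] at he
  all_goals obtain ⟨⟨rfl, rfl⟩, rfl⟩ := he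
  case tailCas.enq | tailCas.deq => exact ⟨_, h.step_tailToN hi hf hs htest⟩
  case linkCas.enq | linkCas.deq => exact ⟨_, h.step_linkOffer hi hf hs htest⟩
  case missed.enq | missed.deq =>
    obtain ⟨hq, hlh, hty, hln⟩ := hs
    exact ⟨_, h.step_headToN hi (by simp [hf.role]) hq hlh hty hln htest
      (.seeking 0 0 { hf with } trivial)⟩
  case swapReady.enq v =>
    obtain ⟨hq, hqt, hlh, hty, hln⟩ := hs
    have hop : H.op q = .deq := by
      cases hop : H.op q
      exacts [absurd (congrArg tyOf hop) hty, rfl]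
    obtain ⟨u, hu⟩ := h.step_exchange (ℓ := .arw .nItemIsNull .putArg) hi hf.role hq hqt hlh hty hln
      (hx nofun) (by rw [hop]; exact htest) (by rw [hop]; rfl)
    exact ⟨_, by rwa [← harg] at hu⟩
  case swapCas.enq => exact absurd hs.2.2.2.2.2.1 nofun
  case swapCas.deq =>
    obtain ⟨hq, hqt, hlh, hty, hln, -, hlx⟩ := hs
    obtain ⟨v, hop⟩ : ∃ v, H.op q = .enq v := by
      cases hop : H.op q
      exacts [⟨_, rfl⟩, absurd (congrArg tyOf hop) hty]
    obtain ⟨u, hu⟩ := h.step_exchange (ℓ := .arw .nItemIsX .putNull) hi hf.role hq hqt hlh hty hln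
      hlx (htest.trans hlx) (by rw [hop]; rfl)
    exact ⟨_, hu⟩

theorem Explains.step_arw (h : Explains env H g τ) (hi : env t = some i) (harg : l.arg = argOf i)
    (hx : i ≠ .deq → l.x = none) (hat : At H g i t l pc) (he : (.arw b a, pc') ∈ pc.edges i)
    (htest : testSem b l g) :
    ∃ H', StepExplained env H H' g (actSem a l g).2 τ t i (.arw b a) l pc' := by
  cases hat with
  | start | atRet | returned => simp [PC.edges] at he
  | seeking p q hf hs => exact h.step_arw_of_seeking hi harg hx hf hs he htest
  | appended k q hr ho ha =>
    cases pc <;> try contradiction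
    all_goals
      cases i <;>
        simp only [PC.edges, List.mem_cons, List.not_mem_nil, Prod.mk.injEq, Kat.Instr.arw.injEq,
          reduceCtorEq, false_and, or_false] at he
    all_goals obtain ⟨⟨rfl, rfl⟩, rfl⟩ := he
    case linked.enq | linked.deq => exact ⟨_, h.step_tailToOffer hi hr ho ha htest⟩
    case headCas.enq | headCas.deq => exact ⟨_, h.step_headToOffer hi hr ho ha.2 ha.1 htest⟩
  | swapped k hk hr hlh hln hty hops =>
    obtain ⟨⟨rfl, rfl⟩, rfl⟩ : (b = .headIsH ∧ a = .headToN) ∧ pc' = .atRet := by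
      simpa [PC.edges] using he
    exact ⟨_, h.step_headToN_of_swapped hi hk hr hlh hln hty hops htest⟩

theorem Explains.step_of_mem_edges (h : Explains env H g τ) (ht : ThreadAt env H g t i l pc)
    (he : (ι, pc') ∈ pc.edges i) (hs : (queue V).InstrStep l g ι ℓ l' g') :
    ∃ H', StepExplained env H H' g g' τ t i ℓ l' pc' := by
  obtain ⟨hi, harg, hx, hat⟩ := ht
  cases hs with
  | act a =>
    by_cases hpc : pc = .start
    · subst hpc
      obtain ⟨rfl, rfl⟩ : a = .newOffer (tyOf i) ∧ pc' = .loop := by simpa [PC.edges] using he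
      cases hat with
      | start hrole => exact ⟨_, h.step_newOffer hi hrole harg⟩
      | seeking _ _ _ hs => exact hs.elim
      | appended _ _ _ _ ha => exact ha.elim
    · have hg : (actSem a l g).2 = g := (actSem_of_mem_edges he hpc).1
      refine ⟨H, ?_, hg.symm ▸ .refl, hg.symm ▸ hat.act h.mem h.block hi hpc he⟩
      exact hg.symm ▸ h.concat hi (by cases i <;> rfl) nofun nofun
  | test b hb =>
    exact ⟨H, h.concat hi (by cases i <;> rfl) nofun nofun, .refl,
      hat.test h.mem h.block hi harg he (iff_of_true hb rfl)⟩
  | ntest b hb =>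
    exact ⟨H, h.concat hi (by cases i <;> rfl) nofun nofun, .refl,
      hat.test h.mem h.block hi harg he (iff_of_false hb Bool.false_ne_true)⟩
  | arw b a hb =>
    have hl : (actSem a l g).1 = l := actSem_fst_of_mem_edges he
    exact hl.symm ▸ h.step_arw hi harg hx hat he hb
  | ret =>
    obtain ⟨⟨k, hk, hops, hr⟩, rfl⟩ := hat.ret h.mem h.block hi hx he
    refine ⟨H, h.concat hi (by cases i <;> rfl) nofun fun r hr' => ?_, .refl,
      .returned ⟨k, hk, hops, hr⟩⟩
    exact ⟨i, k, hk, (Label.ret.inj hr') ▸ hops, hr.imp_right And.left⟩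

end Steps

end SLS

/-! ### The invariant of executions -/

namespace SLS

variable {V T : Type*}

/-- The invariant of executions, for a configuration `C` with the history `H` after the trace
`τ`. -/
structure Inv (env : T → Option (QInv V)) (H : History V T)
    (C : Config T (Loc V) (Shared V) Act Tst)
    (τ : List (T × Label (QInv V) (Option V) Act Tst)) : Prop
    extends Explains env H C.shared τ where
  idle : ∀ t, C.thread t = none → H.role t = .free
  thread : ∀ t l k, C.thread t = some (l, k) →
    ∃ i pc, k = pc.code i ∧ ThreadAt env H C.shared t i l pc
  invoked : ∀ t i, env t = some i → C.thread t ≠ none → (t, .inv i) ∈ τ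

section Preservation

variable {env : T → Option (QInv V)} {H H' : History V T} {g g' : Shared V} {i : QInv V} {t : T}
  {l l' : Loc V} {pc pc' : PC} {k : Option (Kat Act Tst)} {ι : Kat.Instr Act Tst}
  {τ : List (T × Label (QInv V) (Option V) Act Tst)} {ℓ : Label (QInv V) (Option V) Act Tst}
  {C : Config T (Loc V) (Shared V) Act Tst}

theorem arg_eq_of_mem_edges (he : (ι, pc') ∈ pc.edges i)
    (hs : (queue V).InstrStep l g ι ℓ l' g') : l'.arg = l.arg ∧ (i ≠ .deq → l'.x = l.x) := by
  cases hs with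
  | act a =>
    by_cases hpc : pc = .start
    · subst hpc
      obtain ⟨rfl, rfl⟩ : a = .newOffer (tyOf i) ∧ pc' = .loop := by simpa [PC.edges] using he
      exact ⟨rfl, fun _ => rfl⟩
    · exact (actSem_of_mem_edges he hpc).2.2
  | test | ntest | ret => exact ⟨rfl, fun _ => rfl⟩
  | arw b a =>
    have hl : (actSem a l g).1 = l := actSem_fst_of_mem_edges he
    exact ⟨congrArg Loc.arg hl, fun _ => congrArg Loc.x hl⟩

/-- The history before any step. -/
def History.initial (V T : Type*) : History V T where
  address _ := 0
  len := 0
  tail := 0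
  swaps := 0
  head := 0
  role _ := .free
  owner _ := none
  op _ := .deq
  writes _ := []
  ops _ := []
  pos _ := 0

theorem Inv.init (env : T → Option (QInv V)) :
    Inv env (.initial V T) ⟨(queue V).sharedInit, fun _ => none⟩ [] where
  mem := by constructor <;> simp [History.initial, queue, History.type]
  block := nofun
  blockWrites := nofun
  returned := nofun
  inv_lt := nofun
  pos_lt := nofun
  mono := nofun
  pos_inv := nofun
  pos_ret := nofun
  order := .refl
  idle _ _ := rfl
  thread := nofun
  invoked _ _ _ h := absurd rfl h

variable [DecidableEq T]

theorem Inv.update (hI : Inv env H C τ) (h : StepExplained env H H' C.shared g' τ t i ℓ l' pc')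
    (hi : env t = some i) (harg : l'.arg = argOf i) (hx : i ≠ .deq → l'.x = none)
    (hinv : (t, .inv i) ∈ τ ++ [(t, ℓ)]) :
    Inv env H' ⟨g', Function.update C.thread t (some (l', pc'.code i))⟩ (τ ++ [(t, ℓ)]) where
  toExplains := h.explains
  idle u hu := by
    have hut : u ≠ t := by
      rintro rfl
      simp at hu
    rw [h.stepOf.role u hut]
    exact hI.idle u (by simpa [hut] using hu)
  thread u lu ku hu := by
    by_cases hut : u = t
    · subst hut
      obtain ⟨rfl, rfl⟩ : l' = lu ∧ pc'.code i = ku := by simpa using hu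
      exact ⟨i, pc', rfl, hi, harg, hx, h.at_pc⟩
    · obtain ⟨j, pc, hk, hj, hjarg, hjx, hat⟩ := hI.thread u lu ku (by simpa [hut] using hu)
      exact ⟨j, pc, hk, hj, hjarg, hjx, hat.of_stepOf hI.mem h.stepOf hut⟩
  invoked u j hj hu := by
    by_cases hut : u = t
    · subst hut
      rwa [Option.some.inj (hj.symm.trans hi)]
    · exact List.mem_append_left _ (hI.invoked u j hj (by simpa [hut] using hu))

theorem Inv.invoke (hI : Inv env H C τ) (hi : env t = some i) (ht : C.thread t = none) :
    Inv env H
      ⟨C.shared, Function.update C.thread t (some ((queue V).localInit i, some ((queue V).code i)))⟩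
      (τ ++ [(t, .inv i)]) := by
  have hfree := hI.idle t ht
  have hcode : PC.start.code i = some ((queue V).code i) := by rw [queue_code]; rfl
  rw [← hcode]
  exact hI.update
    ⟨hI.concat hi (by cases i <;> rfl) (fun _ _ => hfree) nofun, .refl, .start hfree⟩ hi
    (by cases i <;> rfl) (fun _ => by cases i <;> rfl) (by simp)

theorem Inv.step (hI : Inv env H C τ) (hC : C.thread t = some (l, k))
    (ht : ThreadAt env H C.shared t i l pc) (he : (ι, pc') ∈ pc.edges i)
    (hs : (queue V).InstrStep l C.shared ι ℓ l' g')
    (h : StepExplained env H H' C.shared g' τ t i ℓ l' pc') :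
    Inv env H' ⟨g', Function.update C.thread t (some (l', pc'.code i))⟩ (τ ++ [(t, ℓ)]) := by
  obtain ⟨harg, hx⟩ := arg_eq_of_mem_edges he hs
  exact hI.update h ht.env_eq (harg.trans ht.arg) (fun hd => (hx hd).trans (ht.x_eq hd))
    (List.mem_append_left _ (hI.invoked t i ht.env_eq (by simp [hC])))

theorem exists_inv (h : (queue V).Exec env τ C) : ∃ H, Inv env H C τ := by
  induction h with
  | init => exact ⟨_, .init env⟩
  | inv t i _ hi ht ih =>
    obtain ⟨H, hI⟩ := ih
    exact ⟨H, hI.invoke hi ht⟩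
  | step t _ hC hs ih =>
    obtain ⟨H, hI⟩ := ih
    obtain ⟨i, pc, hk, ht⟩ := hI.thread t _ _ hC
    obtain ⟨ι, pc', he, rfl, hinstr⟩ := (threadStep_queue_iff hk.symm).1 hs
    obtain ⟨H', h⟩ := hI.step_of_mem_edges ht he hinstr
    exact ⟨H', hI.step hC ht he hinstr h⟩

end Preservation

end SLS

/-! ### The linearization of a trace -/

namespace SLS

section QueueRun

variable {V : Type*} {q : List V} {w : List (QInv V × Option V)}

theorem queueRun_of_forall_enq (h : ∀ x ∈ w, ∃ v, x = (.enq v, none)) : QueueRun q w := by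
  induction w generalizing q with
  | nil => exact .nil q
  | cons x w ih =>
    obtain ⟨v, rfl⟩ := h x (by simp)
    exact .enq v (ih fun y hy => h y (by simp [hy]))

theorem queueRun_flatMap_append {ι : Type*} {l : List ι} {f : ι → List (QInv V × Option V)}
    (h : ∀ k ∈ l, ∃ v, f k = [(.enq v, none), (.deq, some v)]) (hw : QueueRun [] w) :
    QueueRun [] (l.flatMap f ++ w) := by
  induction l with
  | nil => exact hw
  | cons k l ih =>
    obtain ⟨v, hv⟩ := h k (by simp)
    rw [List.flatMap_cons, hv]
    exact .enq v (.deq v (ih fun j hj => h j (by simp [hj])))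

end QueueRun

section Blocks

variable {V T : Type*} {env : T → Option (QInv V)} {H : History V T} {g : Shared V}
  {x : T × QInv V × Option V} {i j : QInv V} {t u : T} {k : ℕ}

theorem mem_pendingOps (hx : x ∈ pendingOps t i) : x = (t, i, none) ∧ ∃ v, i = .enq v := by
  cases i with
  | enq v => exact ⟨List.mem_singleton.1 hx, v, rfl⟩
  | deq => exact absurd hx List.not_mem_nil

theorem map_kind_pendingOps : (pendingOps t i).map (fun x => kind x.2.1) =
    [appendLayer (tyOf i), .TA].flatMap marks := by
  cases i <;> rfl

theorem map_kind_rendezvous (hij : tyOf i ≠ tyOf j) :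
    (rendezvous t u i j).map (fun x => kind x.2.1) =
      [appendLayer (tyOf i), .TA, swapLayer (tyOf i), .HR].flatMap marks := by
  cases i <;> cases j <;> first | rfl | exact absurd rfl hij

theorem map_snd_rendezvous (hij : tyOf i ≠ tyOf j) :
    ∃ v, (rendezvous t u i j).map Prod.snd = [(.enq v, none), (.deq, some v)] := by
  cases i <;> cases j <;> first | exact ⟨_, rfl⟩ | exact absurd rfl hij

theorem nodup_map_fst_rendezvous (htu : t ≠ u) : ((rendezvous t u i j).map Prod.fst).Nodup := by
  cases i <;> simp [rendezvous, htu, htu.symm]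

theorem flatMap_marks_blockLayers {ty : NodeType} {tl sw hd : ℕ} :
    (blockLayers ty tl sw hd k).flatMap marks =
      if k < sw then [appendLayer ty, .TA, swapLayer ty, .HR].flatMap marks
      else [appendLayer ty, .TA].flatMap marks := by
  rw [blockLayers]
  split_ifs <;> simp [marks]

theorem Block.map_kind (hb : Block env H g k) (tl hd : ℕ) :
    (H.ops k).map (fun x => kind x.2.1) =
      (blockLayers (H.type (k + 1)) tl H.swaps hd k).flatMap marks := by
  rw [flatMap_marks_blockLayers]
  cases hb with
  | pending _ hsw _ _ hops => rw [hops, if_neg hsw.not_gt, map_kind_pendingOps, History.type]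
  | exchanged _ _ _ hsw _ _ _ _ hty _ hops =>
    rw [hops, if_pos hsw, map_kind_rendezvous hty, History.type]

theorem Block.map_snd_of_lt (hb : Block env H g k) (hk : k < H.swaps) :
    ∃ v, (H.ops k).map Prod.snd = [(.enq v, none), (.deq, some v)] := by
  cases hb with
  | pending _ hsw => exact absurd hk hsw.not_gt
  | exchanged _ _ _ _ _ _ _ _ hty _ hops => exact hops ▸ map_snd_rendezvous hty

theorem Block.enq_of_le (hb : Block env H g k) (hk : H.swaps ≤ k) (hx : x ∈ H.ops k) :
    ∃ v, x.2 = (.enq v, none) := by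
  cases hb with
  | pending _ _ _ _ hops =>
    obtain ⟨rfl, v, hv⟩ := mem_pendingOps (hops ▸ hx)
    exact ⟨v, by rw [hv]⟩
  | exchanged _ _ _ hsw => exact absurd hsw hk.not_gt

theorem Block.of_mem_ops (hb : Block env H g k) (hx : x ∈ H.ops k) :
    (H.role x.1).IsIn k ∧ env x.1 = some x.2.1 := by
  cases hb with
  | pending _ _ hrole henv hops =>
    obtain ⟨rfl, -⟩ := mem_pendingOps (hops ▸ hx)
    exact ⟨.inl hrole, henv⟩
  | exchanged _ _ _ _ hrole henv hroleu henvu _ _ hops =>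
    rcases mem_rendezvous.1 (hops ▸ hx) with rfl | rfl
    exacts [⟨.inl hrole, henv⟩, ⟨.inr hroleu, henvu⟩]

theorem Block.nodup (hb : Block env H g k) : ((H.ops k).map Prod.fst).Nodup := by
  cases hb with
  | pending _ _ _ _ hops =>
    rw [hops]
    cases H.op k <;> simp [pendingOps]
  | exchanged _ _ _ _ hrole _ hroleu _ _ _ hops =>
    rw [hops]
    refine nodup_map_fst_rendezvous ?_
    rintro rfl
    exact nomatch hrole.symm.trans hroleu

end Blocks

/-- The block in which a thread takes part (`0` if it takes part in none). -/
def Role.block : Role → ℕ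
  | .free => 0
  | .app k | .swp k => k

theorem Role.IsIn.block_eq {ρ : Role} {k : ℕ} (h : ρ.IsIn k) : ρ.block = k := by
  rcases h with rfl | rfl <;> rfl

section Linearization

variable {V T : Type*} {env : T → Option (QInv V)} {H : History V T} {j k : ℕ}
  {x y : T × QInv V × Option V} {C : Config T (Loc V) (Shared V) Act Tst}
  {τ : List (T × Label (QInv V) (Option V) Act Tst)}

/-- The operations of a history, in the order of their linearization. -/
def History.linearization (H : History V T) : List (T × QInv V × Option V) :=
  (List.range H.len).flatMap H.ops

/-- The linearization point, in a trace of length `n`, of the operations of a block: the exchange,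
or the last position of the trace if the exchange is still pending. -/
def History.point (H : History V T) (n k : ℕ) : ℕ := if k < H.swaps then H.pos k else n - 1

theorem History.mem_linearization : x ∈ H.linearization ↔ ∃ k < H.len, x ∈ H.ops k := by
  simp [History.linearization]

theorem TraceInv.point_mono (h : TraceInv H τ) (hjk : j ≤ k) :
    H.point τ.length j ≤ H.point τ.length k := by
  simp only [History.point]
  split_ifs with hj hk
  · exact h.mono j k hjk hk
  · exact Nat.le_sub_one_of_lt (h.pos_lt j hj)
  · omega
  · rfl

namespace Inv

theorem swaps_le_len (hI : Inv env H C τ) : H.swaps ≤ H.len := by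
  have hbounds := hI.mem.bounds
  omega

theorem inv_mem (hI : Inv env H C τ) (hk : k < H.len) (hx : x ∈ H.ops k) :
    (x.1, Label.inv x.2.1) ∈ τ := by
  obtain ⟨hin, henv⟩ := (hI.block k hk).of_mem_ops hx
  exact hI.invoked x.1 x.2.1 henv fun hnone => hin.ne_free (hI.idle x.1 hnone)

theorem nodup_linearization (hI : Inv env H C τ) : (H.linearization.map Prod.fst).Nodup := by
  rw [History.linearization, List.map_flatMap, List.nodup_flatMap]
  refine ⟨fun k hk => (hI.block k (List.mem_range.1 hk)).nodup, ?_⟩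
  refine List.pairwise_lt_range.imp_of_mem fun {j k} hj hk hjk t ht ht' => ?_
  obtain ⟨x, hx, rfl⟩ := List.mem_map.1 ht
  obtain ⟨y, hy, hxy⟩ := List.mem_map.1 ht'
  have hxin := ((hI.block j (List.mem_range.1 hj)).of_mem_ops hx).1
  have hyin := ((hI.block k (List.mem_range.1 hk)).of_mem_ops hy).1
  exact hjk.ne (hxin.eq (hxy ▸ hyin))

theorem point_spec (hI : Inv env H C τ) (hk : k < H.len) (hx : x ∈ H.ops k) :
    H.point τ.length k < τ.length ∧
      (∀ j i, τ[j]? = some (x.1, Label.inv i) → j < H.point τ.length k) ∧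
      (∀ j r, τ[j]? = some (x.1, Label.ret r) → H.point τ.length k < j) := by
  have hin := ((hI.block k hk).of_mem_ops hx).1
  rw [History.point]
  split_ifs with hsw
  · exact ⟨hI.pos_lt k hsw, fun j i => hI.pos_inv _ i j k hsw hin,
      fun j r => hI.pos_ret _ r j k hsw hin⟩
  · refine ⟨Nat.sub_lt (List.length_pos_of_mem (hI.inv_mem hk hx)) one_pos, fun j i hj => ?_,
      fun j r hj => ?_⟩
    · exact Nat.lt_sub_of_add_lt (hI.inv_lt x.1 i j hin.ne_free hj)
    · obtain ⟨_, m, hm, -, hin'⟩ := hI.returned _ r (List.mem_of_getElem? hj)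
      exact absurd (hin'.eq hin ▸ hm) hsw

theorem pairwise_point (hI : Inv env H C τ) : H.linearization.Pairwise fun x y =>
    H.point τ.length (H.role x.1).block ≤ H.point τ.length (H.role y.1).block := by
  have hblock {k} {x : T × QInv V × Option V} (hk : k ∈ List.range H.len) (hx : x ∈ H.ops k) :
      (H.role x.1).block = k :=
    ((hI.block k (List.mem_range.1 hk)).of_mem_ops hx).1.block_eq
  refine List.pairwise_flatMap.2 ⟨fun k hk => ?_, ?_⟩
  · refine List.pairwise_of_forall_mem_list fun x hx y hy => ?_
    rw [hblock hk hx, hblock hk hy]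
  · refine List.pairwise_lt_range.imp_of_mem fun {j k} hj hk hjk x hx y hy => ?_
    rw [hblock hj hx, hblock hk hy]
    exact hI.point_mono hjk.le

theorem queueRun_linearization (hI : Inv env H C τ) :
    QueueRun [] (H.linearization.map Prod.snd) := by
  obtain ⟨d, hd⟩ := Nat.exists_eq_add_of_le hI.swaps_le_len
  rw [History.linearization, List.map_flatMap, hd, List.range_add, List.flatMap_append]
  refine queueRun_flatMap_append (fun k hk => ?_) (queueRun_of_forall_enq fun x hx => ?_)
  · have hk := List.mem_range.1 hk
    exact (hI.block k (by omega)).map_snd_of_lt hk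
  · obtain ⟨_, hk, hx⟩ := List.mem_flatMap.1 hx
    obtain ⟨j, hj, rfl⟩ := List.mem_map.1 hk
    have hj := List.mem_range.1 hj
    obtain ⟨y, hy, rfl⟩ := List.mem_map.1 hx
    exact (hI.block (H.swaps + j) (by omega)).enq_of_le (by omega) hy

theorem isLinearization (hI : Inv env H C τ) :
    IsLinearization (queueSpec V) τ H.linearization where
  nodup := hI.nodup_linearization
  returned t r hr := by
    obtain ⟨i, k, hk, hops, -⟩ := hI.returned t r hr
    exact ⟨i, History.mem_linearization.2 ⟨k, hk.trans_le hI.swaps_le_len, hops⟩⟩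
  invoked t i r h := by
    obtain ⟨k, hk, hx⟩ := History.mem_linearization.1 h
    exact hI.inv_mem hk hx
  points := by
    refine ⟨fun t => H.point τ.length (H.role t).block, fun x hx => ?_, hI.pairwise_point⟩
    obtain ⟨k, hk, hx⟩ := History.mem_linearization.1 hx
    have hblock := ((hI.block k hk).of_mem_ops hx).1.block_eq
    simpa only [hblock] using hI.point_spec hk hx
  spec := hI.queueRun_linearization

theorem map_kind_linearization (hI : Inv env H C τ) :
    H.linearization.map (fun x => kind x.2.1) =
      (((List.range H.len).flatMap H.writes).map Prod.snd).flatMap marks := by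
  rw [History.linearization, List.map_flatMap, List.map_flatMap, List.flatMap_assoc]
  refine List.flatMap_congr fun k hk => ?_
  have hk := List.mem_range.1 hk
  rw [(hI.block k hk).map_kind H.tail H.head, (hI.blockWrites k hk).letters]

theorem map_snd_writes_mem_layerExpr (hI : Inv env H C τ) (htail : H.tail = H.len)
    (hhead : H.head = H.swaps) :
    ((List.range H.len).flatMap H.writes).map Prod.snd ∈ layerExpr.matches' := by
  have hletters : ((List.range H.len).flatMap H.writes).map Prod.snd =
      (List.range H.len).flatMap
        fun k => blockLayers (H.type (k + 1)) H.len H.swaps H.swaps k := by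
    rw [List.map_flatMap]
    refine List.flatMap_congr fun k hk => ?_
    rw [(hI.blockWrites k (List.mem_range.1 hk)).letters, htail, hhead]
  rw [hletters]
  exact flatMap_blockLayers_mem_layerExpr hI.swaps_le_len (hhead ▸ hI.mem.same)

end Inv

end Linearization

end SLS

/-! ### The completion of a trace -/

namespace SLS

variable {V T : Type*} {env : T → Option (QInv V)} {H : History V T} {g : Shared V} {i : QInv V}
  {t : T} {l : Loc V} {pc : PC} {k : ℕ}

theorem At.linked_of_role (ha : At H g i t l pc) (hm : MemInv H g) (hrole : H.role t = .app k)
    (hk : H.tail ≤ k) : pc = .linked ∧ l.offer = H.address (k + 1) ∧ l.t = H.address k := by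
  have hbounds := hm.bounds
  have not_served : ¬ Served H i t l := by
    rintro ⟨j, hj, -, hr | ⟨hr, -⟩⟩ <;> cases hrole.symm.trans hr
    omega
  cases ha with
  | start hr | swapped _ _ hr => exact nomatch hrole.symm.trans hr
  | seeking _ _ hf => exact nomatch hrole.symm.trans hf.role
  | appended j q hr ho happ =>
    cases hrole.symm.trans hr
    cases pc <;> simp only [Appended] at happ
    case linked => exact ⟨rfl, ho, happ⟩
    all_goals omega
  | atRet hs | returned hs => exact absurd hs not_served

theorem At.swapped_of_role (ha : At H g i t l pc) (hrole : H.role t = .swp k) (hk : H.head ≤ k) :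
    pc = .swapped ∧ l.h = H.address k ∧ l.n = some (H.address (k + 1)) ∧
      tyOf (H.op k) ≠ tyOf i ∧ (t, i, l.x) ∈ H.ops k := by
  have not_served : ¬ Served H i t l := by
    rintro ⟨j, -, -, hr | ⟨hr, hj⟩⟩ <;> cases hrole.symm.trans hr
    omega
  cases ha with
  | start hr | appended _ _ hr => exact nomatch hrole.symm.trans hr
  | seeking _ _ hf => exact nomatch hrole.symm.trans hf.role
  | swapped j hj hr hlh hln hty hops =>
    cases hrole.symm.trans hr
    exact ⟨rfl, hlh, hln, hty, hops⟩
  | atRet hs | returned hs => exact absurd hs not_served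

theorem Block.exists_app (hb : Block env H g k) : ∃ t, H.role t = .app k := by
  cases hb with
  | pending t _ hrole | exchanged t _ _ _ hrole => exact ⟨t, hrole⟩

theorem Block.exists_swp (hb : Block env H g k) (hk : k < H.swaps) : ∃ t, H.role t = .swp k := by
  cases hb with
  | pending _ hsw => exact absurd hk hsw.not_gt
  | exchanged _ t _ _ _ _ hrole => exact ⟨t, hrole⟩

section Config

variable {C : Config T (Loc V) (Shared V) Act Tst}
  {τ : List (T × Label (QInv V) (Option V) Act Tst)}

theorem Inv.exists_threadAt (hI : Inv env H C τ) (hrole : H.role t ≠ .free) :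
    ∃ i l pc, C.thread t = some (l, pc.code i) ∧ ThreadAt env H C.shared t i l pc := by
  rcases hthread : C.thread t with _ | ⟨l, r⟩
  · exact absurd (hI.idle t hthread) hrole
  · obtain ⟨i, pc, rfl, ht⟩ := hI.thread t l r hthread
    exact ⟨i, l, pc, rfl, ht⟩

variable [DecidableEq T]

theorem exists_tail_eq_len (hC : (queue V).Exec env τ C) (hI : Inv env H C τ) :
    ∃ τ' C' H', (queue V).Exec env (τ ++ τ') C' ∧ Inv env H' C' (τ ++ τ') ∧ τ'.length ≤ 1 ∧
      (C.Final → τ' = [] ∧ C' = C) ∧ H'.tail = H'.len := by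
  have hbounds := hI.mem.bounds
  rcases hbounds.2.2.2.1.eq_or_lt with heq | hlt
  · exact ⟨[], C, H, by simpa using hC, by simpa using hI, by simp, fun _ => ⟨rfl, rfl⟩, heq⟩
  obtain ⟨t, hrole⟩ := (hI.block H.tail hlt).exists_app
  obtain ⟨i, l, pc, hthread, ht⟩ := hI.exists_threadAt (t := t) (by simp [hrole])
  obtain ⟨rfl, hoffer, hlt'⟩ := ht.at_pc.linked_of_role hI.mem hrole le_rfl
  have htest : C.shared.tail = l.t := hI.mem.tail_eq.trans hlt'.symm
  have he : (.arw .tailIsT .tailToOffer, .wait) ∈ PC.linked.edges i := by simp [PC.edges]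
  have hs := ConcObject.InstrStep.arw (O := queue V) Tst.tailIsT Act.tailToOffer htest
  exact ⟨_, _, _, .step t hC hthread ((threadStep_queue_iff rfl).2 ⟨_, _, he, rfl, hs⟩),
    hI.step hthread ht he hs (hI.step_tailToOffer ht.env_eq hrole hoffer hlt' htest), le_rfl,
    fun hF => (nomatch hF t l _ hthread), show H.tail + 1 = H.len by omega⟩

theorem exists_head_eq_swaps (hC : (queue V).Exec env τ C) (hI : Inv env H C τ) :
    ∃ τ' C' H', (queue V).Exec env (τ ++ τ') C' ∧ Inv env H' C' (τ ++ τ') ∧ τ'.length ≤ 1 ∧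
      (C.Final → τ' = []) ∧ H'.head = H'.swaps ∧ (H.tail = H.len → H'.tail = H'.len) := by
  have hbounds := hI.mem.bounds
  rcases hbounds.1.eq_or_lt with heq | hlt
  · exact ⟨[], C, H, by simpa using hC, by simpa using hI, by simp, fun _ => rfl, heq, id⟩
  obtain ⟨t, hrole⟩ := (hI.block H.head (by omega)).exists_swp hlt
  obtain ⟨i, l, pc, hthread, ht⟩ := hI.exists_threadAt (t := t) (by simp [hrole])
  obtain ⟨rfl, hlh, hln, hty, hops⟩ := ht.at_pc.swapped_of_role hrole le_rfl
  have htest : C.shared.head = l.h := hI.mem.head_eq.trans hlh.symm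
  have he : (.arw .headIsH .headToN, .atRet) ∈ PC.swapped.edges i := by simp [PC.edges]
  have hs := ConcObject.InstrStep.arw (O := queue V) Tst.headIsH Act.headToN htest
  exact ⟨_, _, _, .step t hC hthread ((threadStep_queue_iff rfl).2 ⟨_, _, he, rfl, hs⟩),
    hI.step hthread ht he hs
      (hI.step_headToN_of_swapped ht.env_eq hlt hrole hlh hln hty hops htest), le_rfl,
    fun hF => (nomatch hF t l _ hthread), show H.head + 1 = H.swaps by omega, id⟩

theorem exists_complete (hC : (queue V).Exec env τ C) :
    ∃ τ' C' H, (queue V).Exec env (τ ++ τ') C' ∧ Inv env H C' (τ ++ τ') ∧ τ'.length ≤ 2 ∧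
      (C.Final → τ' = []) ∧ H.tail = H.len ∧ H.head = H.swaps := by
  obtain ⟨H, hI⟩ := exists_inv hC
  obtain ⟨τ₁, C₁, H₁, hC₁, hI₁, hlen₁, hfinal₁, htail⟩ := exists_tail_eq_len hC hI
  obtain ⟨τ₂, C₂, H₂, hC₂, hI₂, hlen₂, hfinal₂, hhead, htail₂⟩ := exists_head_eq_swaps hC₁ hI₁
  rw [List.append_assoc] at hC₂ hI₂
  refine ⟨τ₁ ++ τ₂, C₂, H₂, hC₂, hI₂, by rw [List.length_append]; omega, fun hF => ?_,
    htail₂ htail, hhead⟩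
  obtain ⟨rfl, rfl⟩ := hfinal₁ hF
  exact hfinal₂ hF

end Config

end SLS

theorem mainTheorem9 (V T : Type*) [DecidableEq T] :
    (SLS.queue V).Linearizable (queueSpec V) T ∧
    (∀ w ∈ SLS.layerExpr.matches', w.flatMap SLS.marks ∈ SLS.pointExpr.matches') ∧
    ∀ (env : T → Option (QInv V)) τ C, (SLS.queue V).Exec env τ C →
      ∃ τ' C', (SLS.queue V).Exec env (τ ++ τ') C' ∧ τ'.length ≤ 2 ∧ (C.Final → τ' = []) ∧
        ∃ w, Relation.ReflTransGen SLS.Exchange (SLS.writes env (τ ++ τ')) w ∧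
          w.map Prod.snd ∈ SLS.layerExpr.matches' ∧
          ∃ s, IsLinearization (queueSpec V) (τ ++ τ') s ∧
            s.map (fun x => SLS.kind x.2.1) = (w.map Prod.snd).flatMap SLS.marks := by
  refine ⟨fun env τ C hC => ?_, fun w => SLS.flatMap_marks_mem_pointExpr, fun env τ C hC => ?_⟩
  · obtain ⟨H, hI⟩ := SLS.exists_inv hC
    exact ⟨H.linearization, hI.isLinearization⟩
  · obtain ⟨τ', C', H, hC', hI, hlen, hfinal, htail, hhead⟩ := SLS.exists_complete hC
    exact ⟨τ', C', hC', hlen, hfinal, (List.range H.len).flatMap H.writes, hI.order,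
      hI.map_snd_writes_mem_layerExpr htail hhead, H.linearization, hI.isLinearization,
      hI.map_kind_linearization⟩
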